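/- Let $q_0>0$ and $q_\pm\in\mathbb C$ with $|q_+|=|q_-|=q_0$. Fix $t\in\mathbb R$ and let $q=q(x,t)$ satisfy the non-zero boundary conditions $q(x,t)\to q_\pm$ as $x\to\pm\infty$, with $q(\cdot,t)-q_+\in L^1(0,\infty)$ and $q(\cdot,t)-q_-\in L^1(-\infty,0)$. For $z\in\mathbb C\setminus\{0\}$ put $$k(z)=\tfrac12\Bigl(z-\frac{q_0^2}{z}\Bigr),\quad \lambda(z)=\tfrac12\Bigl(z+\frac{q_0^2}{z}\Bigr),\quad \theta(x,t;z)=\lambda(z)\,[x+k(z)t],\quad \sigma_3=\begin{pmatrix}1&0\\0&-1\end{pmatrix},$$ $$Q=\begin{pmatrix}0&q\\-q^*&0\end{pmatrix},\quad Q_\pm=\begin{pmatrix}0&q_\pm\\-q_\pm^*&0\end{pmatrix},\quad \Delta Q_\pm=Q-Q_\pm,\quad Y_\pm(z)=\mathbb I-\tfrac{i}{z}\sigma_3Q_\pm,\quad X=-ik(z)\sigma_3+Q,$$ $$D^\pm=\{z\in\mathbb C:\ \pm(|z|^2-q_0^2)\,\mathrm{Im}\,z>0\},\qquad \Sigma_0=\{z\in\mathbb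 C:\ \mathrm{Im}\,z=0\ \text{or}\ |z|=q_0\}\setminus\{0,\,iq_0,\,-iq_0\}.$$ The modified Jost solutions $u_\pm(x,t;z)$ are the continuous (in $x$) $2\times2$ matrix functions with $u_\pm\to Y_\pm$ as $x\to\pm\infty$ that satisfy, for all $x\in\mathbb R$ and with absolutely convergent integrals, $$u_-(x,t;z)=Y_-+\int_{-\infty}^xY_-e^{-i\lambda(x-y)\sigma_3}Y_-^{-1}\Delta Q_-(y,t)\,u_-(y,t;z)\,e^{i\lambda(x-y)\sigma_3}\,dy,$$ $$u_+(x,t;z)=Y_+-\int_x^{\infty}Y_+e^{-i\lambda(x-y)\sigma_3}Y_+^{-1}\Delta Q_+(y,t)\,u_+(y,t;z)\,e^{i\lambda(x-y)\sigma_3}\,dy.$$ The Jost solutions $\psi_\pm(x,t;z)$ are the solutions of $\psi_x=X\psi$ (in the integrated sense) with $\psi_\pm e^{i\theta\sigma_3}\to Y_\pm$ as $x\to\pm\infty$. The $j$-th column of each of these two problems involves only the $j$-th column $u_{\pm,j}$, respectively $\psi_{\pm,j}$, of the unknown; so the columns may be considered separately, also for $z\notin\Sigma_0$. Then: 1. For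 every $z\in\Sigma_0$ the matrices $u_\pm(\cdot,t;z)$ and $\psi_\pm(\cdot,t;z)$ exist and are unique, and $u_\pm=\psi_\pm e^{i\theta\sigma_3}$. 2. For every $z\in D^-\cup\Sigma_0$ the equations for the columns $u_{+,1}$ and $u_{-,2}$ have unique solutions, which on $\Sigma_0$ are the columns of the matrices in 1. For every $x$ they are analytic in $z\in D^-$ and continuous in $z\in D^-\cup\Sigma_0$. The same holds for $u_{-,1}$ and $u_{+,2}$ with $D^+$ in place of $D^-$. 3. The same holds for the Jost solutions: $\psi_{+,1}$ and $\psi_{-,2}$ exist and are unique for $z\in D^-\cup\Sigma_0$, are analytic in $D^-$ and continuous on $D^-\cup\Sigma_0$; and $\psi_{-,1}$ and $\psi_{+,2}$ exist and are unique for $z\in D^+\cup\Sigma_0$, are analytic in $D^+$ and continuous on $D^+\cup\Sigma_0$. The relations $u_{\pm,1}=e^{i\theta}\psi_{\pm,1}$ and $u_{\pm,2}=e^{-i\theta}\psi_{\pm,2}$ hold throughout these sets. -/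

import Mathlib

open Set Filter Topology MeasureTheory

noncomputable section

namespace KunduEckhaus

/-- The algebra of complex `2 × 2` matrices. -/
abbrev Mat2 : Type := Matrix (Fin 2) (Fin 2) ℂ

/-- The spectral parameter `k(z) = (z - q₀² / z) / 2`. -/
def kOf (q0 : ℝ) (z : ℂ) : ℂ := (z - (q0 : ℂ) ^ 2 / z) / 2

/-- `λ(z) = (z + q₀² / z) / 2`. -/
def lam (q0 : ℝ) (z : ℂ) : ℂ := (z + (q0 : ℂ) ^ 2 / z) / 2

/-- The phase `θ(x,t;z) = λ(z) (x + k(z) t)`. -/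
def theta (q0 : ℝ) (x t : ℝ) (z : ℂ) : ℂ := lam q0 z * ((x : ℂ) + kOf q0 z * (t : ℂ))

/-- The Pauli matrix `σ₃`. -/
def sigma3 : Mat2 := !![1, 0; 0, -1]

/-- The diagonal matrix `e^{a σ₃}`. -/
def expSigma3 (a : ℂ) : Mat2 := !![Complex.exp a, 0; 0, Complex.exp (-a)]

/-- The potential matrix with off-diagonal entries `q` and `-q*`. -/
def potMat (q : ℂ) : Mat2 := !![0, q; -(starRingEnd ℂ q), 0]

/-- The matrix `X(x,t;z) = -i k(z) σ₃ + Q(x,t)` of the `x`-part of the Lax pair. -/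
def laxX (q0 : ℝ) (q : ℝ → ℝ → ℂ) (x t : ℝ) (z : ℂ) : Mat2 :=
  (-Complex.I * kOf q0 z) • sigma3 + potMat (q x t)

/-- The eigenvector matrix `Y(z) = 1 - (i / z) σ₃ Q_s` of the asymptotic problem with boundary
value `qs`. -/
def asymY (qs z : ℂ) : Mat2 := 1 - (Complex.I / z) • (sigma3 * potMat qs)

/-- `D⁺ = {z : (|z|² - q₀²) Im z > 0}`. -/
def DPlus (q0 : ℝ) : Set ℂ := {z | 0 < (‖z‖ ^ 2 - q0 ^ 2) * z.im}

/-- `D⁻ = {z : (|z|² - q₀²) Im z < 0}`. -/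
def DMinus (q0 : ℝ) : Set ℂ := {z | (‖z‖ ^ 2 - q0 ^ 2) * z.im < 0}

/-- The continuous spectrum (the real line and the circle of radius `q₀`), without the origin,
where `λ` and `Y` have a pole, and without the branch points `± i q₀`. -/
def Sigma0 (q0 : ℝ) : Set ℂ :=
  {z | (z.im = 0 ∨ ‖z‖ = q0) ∧ z ≠ 0 ∧
    z ≠ Complex.I * (q0 : ℂ) ∧ z ≠ -(Complex.I * (q0 : ℂ))}

/-- The factor `Y e^{-iλ(x-y)σ₃} Y⁻¹ ΔQ(y,t)` standing to the left of the unknown in the Volterra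
equations; here `ΔQ = Q - Q_s`. -/
def volterraLeft (q0 : ℝ) (q : ℝ → ℝ → ℂ) (qs : ℂ) (t : ℝ) (z : ℂ) (x y : ℝ) : Mat2 :=
  asymY qs z * expSigma3 (-(Complex.I * lam q0 z * ((x : ℂ) - (y : ℂ)))) * (asymY qs z)⁻¹ *
    (potMat (q y t) - potMat qs)

/-- The factor `e^{iλ(x-y)σ₃}` standing to the right of the unknown in the Volterra equations. -/
def volterraRight (q0 : ℝ) (z : ℂ) (x y : ℝ) : Mat2 :=
  expSigma3 (Complex.I * lam q0 z * ((x : ℂ) - (y : ℂ)))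

/-- `U = u₊(·,t;z)`: a continuous matrix function with `U → Y₊` as `x → +∞` and
`U(x) = Y₊ - ∫_x^∞ Y₊ e^{-iλ(x-y)σ₃} Y₊⁻¹ ΔQ₊(y,t) U(y) e^{iλ(x-y)σ₃} dy` for all `x`,
the integral being absolutely convergent. -/
def IsModifiedJostPlus (q0 : ℝ) (q : ℝ → ℝ → ℂ) (qp : ℂ) (t : ℝ) (z : ℂ) (U : ℝ → Mat2) : Prop :=
  Continuous U ∧ Tendsto U atTop (𝓝 (asymY qp z)) ∧
  ∀ (x : ℝ) (i j : Fin 2),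
    IntegrableOn
      (fun y => (volterraLeft q0 q qp t z x y * U y * volterraRight q0 z x y) i j) (Ioi x) ∧
    U x i j = asymY qp z i j -
      ∫ y in Ioi x, (volterraLeft q0 q qp t z x y * U y * volterraRight q0 z x y) i j

/-- `U = u₋(·,t;z)`: a continuous matrix function with `U → Y₋` as `x → -∞` and
`U(x) = Y₋ + ∫_{-∞}^x Y₋ e^{-iλ(x-y)σ₃} Y₋⁻¹ ΔQ₋(y,t) U(y) e^{iλ(x-y)σ₃} dy` for all `x`,
the integral being absolutely convergent. -/
def IsModifiedJostMinus (q0 : ℝ) (q : ℝ → ℝ → ℂ) (qm : ℂ) (t : ℝ) (z : ℂ) (U : ℝ → Mat2) : Prop :=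
  Continuous U ∧ Tendsto U atBot (𝓝 (asymY qm z)) ∧
  ∀ (x : ℝ) (i j : Fin 2),
    IntegrableOn
      (fun y => (volterraLeft q0 q qm t z x y * U y * volterraRight q0 z x y) i j) (Iio x) ∧
    U x i j = asymY qm z i j +
      ∫ y in Iio x, (volterraLeft q0 q qm t z x y * U y * volterraRight q0 z x y) i j

/-- The `j`-th column of the Volterra equation of `u₊`. As `e^{iλ(x-y)σ₃}` is diagonal, the `j`-th
column of that equation involves the `j`-th column of the unknown only. -/
def IsModifiedJostColPlus (q0 : ℝ) (q : ℝ → ℝ → ℂ) (qp : ℂ) (t : ℝ) (j : Fin 2) (z : ℂ)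
    (v : ℝ → Fin 2 → ℂ) : Prop :=
  Continuous v ∧ Tendsto v atTop (𝓝 ((asymY qp z).col j)) ∧
  ∀ x : ℝ,
    IntegrableOn
      (fun y => volterraRight q0 z x y j j •
        Matrix.mulVec (volterraLeft q0 q qp t z x y) (v y)) (Ioi x) ∧
    v x = (asymY qp z).col j -
      ∫ y in Ioi x, volterraRight q0 z x y j j •
        Matrix.mulVec (volterraLeft q0 q qp t z x y) (v y)

/-- The `j`-th column of the Volterra equation of `u₋`. -/
def IsModifiedJostColMinus (q0 : ℝ) (q : ℝ → ℝ → ℂ) (qm : ℂ) (t : ℝ) (j : Fin 2) (z : ℂ)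
    (v : ℝ → Fin 2 → ℂ) : Prop :=
  Continuous v ∧ Tendsto v atBot (𝓝 ((asymY qm z).col j)) ∧
  ∀ x : ℝ,
    IntegrableOn
      (fun y => volterraRight q0 z x y j j •
        Matrix.mulVec (volterraLeft q0 q qm t z x y) (v y)) (Iio x) ∧
    v x = (asymY qm z).col j +
      ∫ y in Iio x, volterraRight q0 z x y j j •
        Matrix.mulVec (volterraLeft q0 q qm t z x y) (v y)

/-- `Ψ = ψ(·,t;z)` is a (matrix) Jost solution normalised at the end `l` of the line (`atTop` or
`atBot`) with boundary value `qs`: it solves `Ψ_x = X Ψ` and `Ψ e^{iθσ₃} → Y` along `l`.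
The differential equation is written in integrated form, which is the usual meaning for a
potential that is only locally integrable, and the classical one if `q(·,t)` is continuous. -/
def IsJost (l : Filter ℝ) (q0 : ℝ) (q : ℝ → ℝ → ℂ) (qs : ℂ) (t : ℝ) (z : ℂ)
    (Ψ : ℝ → Mat2) : Prop :=
  Continuous Ψ ∧
  (∀ (a b : ℝ) (i j : Fin 2),
    Ψ b i j - Ψ a i j = ∫ y in a..b, (laxX q0 q y t z * Ψ y) i j) ∧
  Tendsto (fun x => Ψ x * expSigma3 (Complex.I * theta q0 x t z)) l (𝓝 (asymY qs z))

/-- The `j`-th column of a Jost solution: a vector solution of the same equation, with the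
`j`-th column of the normalisation. -/
def IsJostCol (l : Filter ℝ) (q0 : ℝ) (q : ℝ → ℝ → ℂ) (qs : ℂ) (t : ℝ) (j : Fin 2) (z : ℂ)
    (w : ℝ → Fin 2 → ℂ) : Prop :=
  Continuous w ∧
  (∀ a b : ℝ, w b - w a = ∫ y in a..b, Matrix.mulVec (laxX q0 q y t z) (w y)) ∧
  Tendsto (fun x => expSigma3 (Complex.I * theta q0 x t z) j j • w x) l
    (𝓝 ((asymY qs z).col j))

/-- `f` is the only function of `x` that satisfies `P`. -/
def IsTheUnique {α : Type} (P : (ℝ → α) → Prop) (f : ℝ → α) : Prop :=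
  P f ∧ ∀ g : ℝ → α, P g → g = f

/-- For every `z ∈ D ∪ S` the function `v(·;z)` is the unique solution of the problem `P z`, and
for every `x` the function `v(x;·)` is analytic in `D` and continuous on `D ∪ S`. -/
def IsAnalyticSolution (P : ℂ → (ℝ → Fin 2 → ℂ) → Prop) (D S : Set ℂ)
    (v : ℝ → ℂ → Fin 2 → ℂ) : Prop :=
  (∀ z ∈ D ∪ S, IsTheUnique (P z) (fun x => v x z)) ∧
  ∀ x : ℝ, AnalyticOnNhd ℂ (v x) D ∧ ContinuousOn (v x) (D ∪ S)

end KunduEckhaus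

end

/-!
The `j`-th column `v` of the Volterra equations and the `j`-th column `w` of the differential
equation are two forms of one problem. Put `v = e^{± iθ} w`. Since the columns of `Y` are
eigenvectors of the asymptotic matrix `-ikσ₃ + Q_s` with eigenvalues `∓ iλ`, the equation for `w`
becomes `v' = α p v + ΔQ v`, where `α = ± 2iλ` and `p = Y D Y⁻¹` is the spectral projection that
annihilates the `j`-th column of `Y`, which is the prescribed limit of `v`. Variation of constants
turns this into the Volterra equation with the kernel `((1 - p) + e^{α(x-y)} p) ΔQ(y)`
(`isLinearSol_iff_isVolterraSol`, `smul_volterraLeft_mulVec`, `isJostCol_iff`). As `ΔQ` is only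
integrable, derivatives exist only almost everywhere, and the product rule is that of absolutely
continuous functions (`exp_smul_sub_eq_integral`).

The half-domains are exactly what makes the kernel bounded: `Im λ` has the sign of
`(|z|² - q₀²) Im z`, hence `e^{α(x-y)}` has modulus at most `1` between `x` and the end at which
the solution is normalised. For a bounded kernel and an integrable `ΔQ` the `n`-th term of the
Neumann series is at most `(C M(x))ⁿ / n!` times the norm of the limit, where `M(x)` is the mass of
`‖ΔQ‖` between `x` and that end (`integral_mul_tail_pow`, `volterraTerm_bound`). This gives
existence, and the same estimate applied to the difference of two solutions gives uniqueness. The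
bounds are locally uniform in `z`, so the sum inherits continuity from its terms, and holomorphy as
well; each term is holomorphic as an integral of holomorphic functions with an integrable bound
(`differentiableOn_volterraSol`, `differentiableOn_integral_of_dominated`).

All this is done for equations in a Banach space normalised at `+∞`; the end `-∞` is obtained by
the reflection `x ↦ -x` (`isVolterraSolBot_iff`, `isLinearSol_atBot_iff`). On the continuous
spectrum `α` is imaginary, so both columns exist at each end and form the matrix solutions.
-/

namespace JostVolterra

/-! ### Absolutely continuous functions and the product rule -/

section Calculus

variable {E : Type*} [NormedAddCommGroup E]

theorem intervalIntegrable_of_locallyIntegrable {g : ℝ → E} (hg : LocallyIntegrable g volume)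
    (a b : ℝ) : IntervalIntegrable g volume a b :=
  intervalIntegrable_iff.mpr <|
    (hg.integrableOn_isCompact isCompact_uIcc).mono_set uIoc_subset_uIcc

variable [NormedSpace ℂ E]

theorem absolutelyContinuousOnInterval_of_sub_eq_integral {f g : ℝ → E}
    (hg : LocallyIntegrable g volume)
    (hf : ∀ a b, f b - f a = ∫ y in a..b, g y) (a b : ℝ) :
    AbsolutelyContinuousOnInterval f a b := by
  have hgi := intervalIntegrable_of_locallyIntegrable hg
  have hreal := ((hgi a b).norm).absolutelyContinuousOnInterval_intervalIntegral
    (c := a) left_mem_uIcc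
  refine squeeze_zero' (Eventually.of_forall fun _ => Finset.sum_nonneg fun _ _ => dist_nonneg)
    (Eventually.of_forall fun I => Finset.sum_le_sum fun i _ => ?_) hreal
  set c := (I.2 i).1
  set d := (I.2 i).2
  rw [dist_eq_norm, hf, Real.dist_eq,
    intervalIntegral.integral_interval_sub_left (hgi a c).norm (hgi a d).norm]
  exact intervalIntegral.norm_integral_le_abs_integral_norm

variable [CompleteSpace E]

/-- The fundamental theorem of calculus for vector-valued absolutely continuous functions. -/
theorem sub_eq_integral_of_absolutelyContinuous {F g : ℝ → E} {a b : ℝ}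
    (hg : LocallyIntegrable g volume)
    (hF : AbsolutelyContinuousOnInterval F a b)
    (hd : ∀ᵐ x, HasDerivAt F (g x) x) :
    F b - F a = ∫ y in a..b, g y := by
  have hgi := intervalIntegrable_of_locallyIntegrable hg
  have hI : AbsolutelyContinuousOnInterval (fun x => ∫ y in a..x, g y) a b :=
    absolutelyContinuousOnInterval_of_sub_eq_integral hg (fun c d =>
      intervalIntegral.integral_interval_sub_left (hgi a d) (hgi a c)) a b
  obtain ⟨C, hC⟩ := (hF.sub hI).const_of_ae_hasDerivAt_zero (by
    filter_upwards [hd, LocallyIntegrable.ae_hasDerivAt_integral hg] with x h1 h2 _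
    simpa using! h1.sub (h2 a))
  have h1 := hC a left_mem_uIcc
  have h2 := hC b right_mem_uIcc
  simp only [Pi.sub_apply, intervalIntegral.integral_same, sub_zero] at h1 h2
  rw [h1, ← h2]; abel

/-- The Lebesgue differentiation theorem for a primitive. -/
theorem ae_hasDerivAt_of_sub_eq_integral {f g : ℝ → E}
    (hg : LocallyIntegrable g volume)
    (hf : ∀ a b, f b - f a = ∫ y in a..b, g y) :
    ∀ᵐ x, HasDerivAt f (g x) x := by
  filter_upwards [LocallyIntegrable.ae_hasDerivAt_integral hg] with x hx
  have : f = fun x => f 0 + ∫ y in (0:ℝ)..x, g y := by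
    funext x; rw [← hf]; abel
  rw [this]
  exact (hx 0).const_add _

theorem hasDerivAt_cexp_mul (β : ℂ) (x : ℝ) :
    HasDerivAt (fun x : ℝ => Complex.exp (β * x)) (β * Complex.exp (β * x)) x := by
  have h := (((hasDerivAt_id (x : ℂ)).const_mul β).cexp).comp_ofReal
  simpa [mul_comm] using! h

/-- The product rule, in integrated form, for an exponential and a function that is the primitive
of a locally integrable function. -/
theorem exp_smul_sub_eq_integral {f g : ℝ → E} (β : ℂ) (hfc : Continuous f)
    (hg : LocallyIntegrable g volume)
    (hf : ∀ a b, f b - f a = ∫ y in a..b, g y) (a b : ℝ) :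
    Complex.exp (β * b) • f b - Complex.exp (β * a) • f a =
      ∫ y in a..b, Complex.exp (β * y) • (β • f y + g y) := by
  have hexp : Continuous fun x : ℝ => Complex.exp (β * x) := by fun_prop
  have hint : LocallyIntegrable (fun y : ℝ => Complex.exp (β * y) • (β • f y + g y)) volume :=
    ((hfc.const_smul β).locallyIntegrable.add hg).continuous_smul hexp
  refine sub_eq_integral_of_absolutelyContinuous
    (F := fun x : ℝ => Complex.exp (β * x) • f x) hint ?_ ?_
  · refine AbsolutelyContinuousOnInterval.fun_smul ?_
      (absolutelyContinuousOnInterval_of_sub_eq_integral hg hf a b)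
    have hc : Continuous fun x : ℝ => β * Complex.exp (β * x) := by fun_prop
    exact absolutelyContinuousOnInterval_of_sub_eq_integral hc.locallyIntegrable
      (fun a b => (intervalIntegral.integral_eq_sub_of_hasDerivAt
        (fun x _ => hasDerivAt_cexp_mul β x) (hc.intervalIntegrable a b)).symm) a b
  · filter_upwards [ae_hasDerivAt_of_sub_eq_integral hg hf] with x hx
    convert! (hasDerivAt_cexp_mul β x).smul hx using 1
    rw [smul_add, smul_smul, mul_comm β (Complex.exp _), add_comm]

end Calculus

/-! ### Iterated integrals of an integrable function -/

section Tail

/-- The mass of `m` to the right of `x`. -/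
noncomputable def tail (m : ℝ → ℝ) (x : ℝ) : ℝ := ∫ y in Ioi x, m y

variable {m : ℝ → ℝ}

theorem tail_nonneg (h0 : ∀ y, 0 ≤ m y) (x : ℝ) : 0 ≤ tail m x :=
  integral_nonneg fun _ => h0 _

theorem locallyIntegrable_of_integrableOn_Ioi {E : Type*} [NormedAddCommGroup E] {m : ℝ → E}
    (hm : ∀ x, IntegrableOn m (Ioi x)) :
    LocallyIntegrable m volume := by
  intro x
  exact ⟨Ioi (x - 1), Ioi_mem_nhds (by linarith), hm _⟩

theorem tail_sub (hm : ∀ x, IntegrableOn m (Ioi x)) (a b : ℝ) :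
    tail m b - tail m a = ∫ y in a..b, - m y := by
  rw [intervalIntegral.integral_neg,
    ← intervalIntegral.integral_Ioi_sub_Ioi' (hm a) (hm b), tail, tail]
  ring

theorem continuous_tail (hm : ∀ x, IntegrableOn m (Ioi x)) : Continuous (tail m) := by
  have h : tail m = fun x => tail m 0 + ∫ y in (0:ℝ)..x, - m y := by
    funext x; rw [← tail_sub hm]; ring
  rw [h]
  exact continuous_const.add (intervalIntegral.continuous_primitive
    (intervalIntegrable_of_locallyIntegrable
      (locallyIntegrable_of_integrableOn_Ioi hm).neg) 0)

theorem tail_antitone (h0 : ∀ y, 0 ≤ m y) (hm : ∀ x, IntegrableOn m (Ioi x)) :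
    Antitone (tail m) := fun a _ hab =>
  setIntegral_mono_set (hm a) (Eventually.of_forall h0) (Ioi_subset_Ioi hab).eventuallyLE

theorem tendsto_tail (hm : ∀ x, IntegrableOn m (Ioi x)) :
    Tendsto (tail m) atTop (𝓝 0) := by
  have h := intervalIntegral_tendsto_integral_Ioi 0 (hm 0) tendsto_id
  have h2 : tail m = fun x => tail m 0 - ∫ y in (0:ℝ)..x, m y := by
    funext x
    have := tail_sub hm 0 x
    rw [intervalIntegral.integral_neg] at this
    linarith
  rw [h2]
  simpa [tail] using h.const_sub (tail m 0)

theorem integrableOn_mul_tail_pow (h0 : ∀ y, 0 ≤ m y) (hm : ∀ x, IntegrableOn m (Ioi x)) (n : ℕ)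
    (x : ℝ) : IntegrableOn (fun y => m y * tail m y ^ n) (Ioi x) := by
  refine Integrable.mono' ((hm x).mul_const (tail m x ^ n))
    ((hm x).aestronglyMeasurable.mul ((continuous_tail hm).pow n).aestronglyMeasurable) ?_
  filter_upwards [ae_restrict_mem measurableSet_Ioi] with y hy
  rw [norm_mul, norm_pow, Real.norm_of_nonneg (h0 y), Real.norm_of_nonneg (tail_nonneg h0 y)]
  exact mul_le_mul_of_nonneg_left
    (pow_le_pow_left₀ (tail_nonneg h0 y) (tail_antitone h0 hm (le_of_lt hy)) n) (h0 y)

theorem absolutelyContinuous_tail_pow (hm : ∀ x, IntegrableOn m (Ioi x)) (n : ℕ) (a b : ℝ) :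
    AbsolutelyContinuousOnInterval (fun x => tail m x ^ n) a b := by
  have h1 : AbsolutelyContinuousOnInterval (tail m) a b := by
    have h := IntervalIntegrable.absolutelyContinuousOnInterval_intervalIntegral (c := a)
      (intervalIntegrable_of_locallyIntegrable
        (locallyIntegrable_of_integrableOn_Ioi hm) a b).neg left_mem_uIcc
    refine squeeze_zero' (Eventually.of_forall fun _ => Finset.sum_nonneg fun _ _ => dist_nonneg)
      (Eventually.of_forall fun I => Finset.sum_le_sum fun i _ => le_of_eq ?_) h
    simp only [Real.dist_eq, Pi.neg_apply, ← tail_sub hm]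
    congr 1; ring
  induction n with
  | zero =>
    simpa using! (LipschitzWith.const (1:ℝ)).lipschitzOnWith.absolutelyContinuousOnInterval
      (a := a) (b := b)
  | succ n ih => simpa only [pow_succ] using ih.fun_mul h1

/-- The iterated tails of `m`: integrating over the simplex `x < y₁ < ⋯ < yₙ` gains the factor
`1 / n!` that makes a Volterra series converge without any smallness assumption. -/
theorem integral_mul_tail_pow (h0 : ∀ y, 0 ≤ m y) (hm : ∀ x, IntegrableOn m (Ioi x)) (n : ℕ)
    (x : ℝ) : ∫ y in Ioi x, m y * tail m y ^ n = tail m x ^ (n + 1) / (n + 1) := by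
  have hint : ∀ x, IntegrableOn (fun y => -((n + 1 : ℝ) * (m y * tail m y ^ n))) (Ioi x) :=
    fun x => ((integrableOn_mul_tail_pow h0 hm n x).const_mul _).neg
  have hloc := locallyIntegrable_of_integrableOn_Ioi hm
  have key : ∀ b, tail m b ^ (n + 1) - tail m x ^ (n + 1) =
      ∫ y in x..b, -((n + 1 : ℝ) * (m y * tail m y ^ n)) := by
    intro b
    have hac := absolutelyContinuous_tail_pow hm (n + 1) x b
    rw [← hac.integral_deriv_eq_sub]
    refine intervalIntegral.integral_congr_ae ?_
    filter_upwards [LocallyIntegrable.ae_hasDerivAt_integral hloc.neg] with y hy _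
    have h2 : tail m = fun x => tail m 0 + ∫ y in (0:ℝ)..x, - m y := by
      funext x; rw [← tail_sub hm]; ring
    have hd : HasDerivAt (tail m) (- m y) y := by
      rw [h2]; exact (hy 0).const_add _
    rw [(hd.fun_pow (n + 1)).deriv]
    push_cast
    ring
  have h1 := intervalIntegral_tendsto_integral_Ioi x (hint x) tendsto_id
  have h2 : Tendsto (fun b => tail m b ^ (n + 1) - tail m x ^ (n + 1)) atTop
      (𝓝 (0 ^ (n + 1) - tail m x ^ (n + 1))) := ((tendsto_tail hm).pow (n + 1)).sub_const _
  have h3 := tendsto_nhds_unique (h1.congr fun b => (key b).symm) h2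
  rw [integral_neg, integral_const_mul, zero_pow (Nat.succ_ne_zero n), zero_sub, neg_inj] at h3
  rw [← h3]
  field_simp

end Tail

/-! ### Volterra equations at `+∞`: existence and uniqueness -/

section Volterra

variable {E : Type*} [NormedAddCommGroup E] [NormedSpace ℂ E]

/-- The solution operator, over the backward time `s`, of the linear equation `v' = α p v` in which
`p` is a projection: it is `1` on the kernel of `p` and `e^{-α s}` on its range. -/
noncomputable def propagator (α : ℂ) (p : E →L[ℂ] E) (s : ℝ) : E →L[ℂ] E :=
  (1 - p) + Complex.exp (-(α * s)) • p

/-- The Volterra integral operator with the perturbation `P`, integrating from `+∞`. -/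
noncomputable def volterraOp (α : ℂ) (p : E →L[ℂ] E) (P : ℝ → E →L[ℂ] E) (v : ℝ → E) (x : ℝ) : E :=
  -∫ y in Ioi x, propagator α p (y - x) (P y (v y))

/-- `v` solves the Volterra equation of `v' = α p v + P v` with the limit `b` at `+∞`. -/
def IsVolterraSol (α : ℂ) (p : E →L[ℂ] E) (P : ℝ → E →L[ℂ] E) (b : E) (v : ℝ → E) : Prop :=
  Continuous v ∧ Tendsto v atTop (𝓝 b) ∧
  ∀ x, IntegrableOn (fun y => propagator α p (y - x) (P y (v y))) (Ioi x) ∧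
    v x = b - ∫ y in Ioi x, propagator α p (y - x) (P y (v y))

theorem norm_propagator_le {α : ℂ} (hα : 0 ≤ α.re) (p : E →L[ℂ] E) {s : ℝ} (hs : 0 ≤ s) :
    ‖propagator α p s‖ ≤ ‖1 - p‖ + ‖p‖ := by
  refine (norm_add_le _ _).trans (add_le_add le_rfl ?_)
  rw [norm_smul, Complex.norm_exp]
  refine mul_le_of_le_one_left (norm_nonneg _) (Real.exp_le_one_iff.2 ?_)
  simp only [Complex.neg_re, Complex.mul_re, Complex.ofReal_re, Complex.ofReal_im, mul_zero,
    sub_zero, neg_nonpos]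
  positivity

theorem norm_propagator_apply_le {α : ℂ} (hα : 0 ≤ α.re) (p : E →L[ℂ] E) {C : ℝ}
    (hC : ‖1 - p‖ + ‖p‖ ≤ C) {x y : ℝ} (hxy : x < y) (e : E) :
    ‖propagator α p (y - x) e‖ ≤ C * ‖e‖ :=
  (ContinuousLinearMap.le_opNorm _ _).trans
    (mul_le_mul_of_nonneg_right ((norm_propagator_le hα p (sub_pos.2 hxy).le).trans hC)
      (norm_nonneg _))

theorem continuous_propagator (α : ℂ) (p : E →L[ℂ] E) : Continuous (propagator α p) := by
  unfold propagator
  fun_prop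

variable {P : ℝ → E →L[ℂ] E} {v : ℝ → E}

theorem aestronglyMeasurable_apply (hP : ∀ x, IntegrableOn P (Ioi x)) (hv : Continuous v)
    (x : ℝ) : AEStronglyMeasurable (fun y => P y (v y)) (volume.restrict (Ioi x)) :=
  (isBoundedBilinearMap_apply (𝕜 := ℂ) (E := E) (F := E)).continuous.comp_aestronglyMeasurable
    ((hP x).aestronglyMeasurable.prodMk hv.aestronglyMeasurable)

theorem integrableOn_apply (hP : ∀ x, IntegrableOn P (Ioi x)) (hv : Continuous v)
    {B x : ℝ} (hB : ∀ y, x < y → ‖v y‖ ≤ B) : IntegrableOn (fun y => P y (v y)) (Ioi x) := by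
  refine Integrable.mono' ((hP x).norm.mul_const B) (aestronglyMeasurable_apply hP hv x) ?_
  filter_upwards [ae_restrict_mem measurableSet_Ioi] with y hy
  exact (ContinuousLinearMap.le_opNorm _ _).trans
    (mul_le_mul_of_nonneg_left (hB y hy) (norm_nonneg _))

theorem aestronglyMeasurable_kernel (α : ℂ) (p : E →L[ℂ] E)
    (hP : ∀ x, IntegrableOn P (Ioi x)) (hv : Continuous v) (x : ℝ) :
    AEStronglyMeasurable (fun y => propagator α p (y - x) (P y (v y)))
      (volume.restrict (Ioi x)) :=
  (isBoundedBilinearMap_apply (𝕜 := ℂ) (E := E) (F := E)).continuous.comp_aestronglyMeasurable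
    ((((continuous_propagator α p).comp
      (continuous_id.sub continuous_const)).aestronglyMeasurable).prodMk
      (aestronglyMeasurable_apply hP hv x))

theorem integrableOn_kernel {α : ℂ} (hα : 0 ≤ α.re) (p : E →L[ℂ] E)
    (hP : ∀ x, IntegrableOn P (Ioi x)) (hv : Continuous v) {x : ℝ}
    (hPv : IntegrableOn (fun y => P y (v y)) (Ioi x)) :
    IntegrableOn (fun y => propagator α p (y - x) (P y (v y))) (Ioi x) := by
  refine Integrable.mono' (hPv.norm.const_mul (‖1 - p‖ + ‖p‖))
    (aestronglyMeasurable_kernel α p hP hv x) ?_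
  filter_upwards [ae_restrict_mem measurableSet_Ioi] with y hy
  exact norm_propagator_apply_le hα p le_rfl hy _

theorem norm_kernel_le {α : ℂ} (hα : 0 ≤ α.re) {p : E →L[ℂ] E} {B C : ℝ}
    (hC : ‖1 - p‖ + ‖p‖ ≤ C) {n : ℕ} {x y : ℝ} (hxy : x < y)
    (hB : ‖v y‖ ≤ B * ((C * tail (fun y => ‖P y‖) y) ^ n / n.factorial)) :
    ‖propagator α p (y - x) (P y (v y))‖ ≤
      B * C ^ (n + 1) / n.factorial * (‖P y‖ * tail (fun y => ‖P y‖) y ^ n) := by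
  have hC0 : 0 ≤ C := (add_nonneg (norm_nonneg _) (norm_nonneg _)).trans hC
  calc _ ≤ C * ‖P y (v y)‖ := norm_propagator_apply_le hα p hC hxy _
    _ ≤ C * (‖P y‖ * (B * ((C * tail (fun y => ‖P y‖) y) ^ n / n.factorial))) := by
        gcongr
        exact (ContinuousLinearMap.le_opNorm _ _).trans
          (mul_le_mul_of_nonneg_left hB (norm_nonneg _))
    _ = _ := by rw [mul_pow, pow_succ]; ring

/-- One application of the Volterra operator improves a bound of order `n` in the tail of `‖P‖` to
one of order `n + 1`, with the factor `1 / (n + 1)`. -/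
theorem integral_norm_kernel_le {α : ℂ} (hα : 0 ≤ α.re) (p : E →L[ℂ] E)
    (hP : ∀ x, IntegrableOn P (Ioi x)) (hv : Continuous v) {B C : ℝ}
    (hC : ‖1 - p‖ + ‖p‖ ≤ C) {n : ℕ} {x : ℝ}
    (hB : ∀ y, x < y → ‖v y‖ ≤ B * ((C * tail (fun y => ‖P y‖) y) ^ n / n.factorial)) :
    IntegrableOn (fun y => propagator α p (y - x) (P y (v y))) (Ioi x) ∧
    ∫ y in Ioi x, ‖propagator α p (y - x) (P y (v y))‖ ≤
      B * ((C * tail (fun y => ‖P y‖) x) ^ (n + 1) / (n + 1).factorial) := by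
  set m : ℝ → ℝ := fun y => ‖P y‖ with hm_def
  have h0 : ∀ y, 0 ≤ m y := fun y => norm_nonneg _
  have hm : ∀ x, IntegrableOn m (Ioi x) := fun x => (hP x).norm
  have hbi : IntegrableOn (fun y => B * C ^ (n + 1) / n.factorial * (m y * tail m y ^ n))
      (Ioi x) := (integrableOn_mul_tail_pow h0 hm n x).const_mul _
  have hle : ∀ y, x < y → ‖propagator α p (y - x) (P y (v y))‖ ≤
      B * C ^ (n + 1) / n.factorial * (m y * tail m y ^ n) := fun y hy =>
    norm_kernel_le hα hC hy (hB y hy)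
  have hint : IntegrableOn (fun y => propagator α p (y - x) (P y (v y))) (Ioi x) := by
    refine Integrable.mono' hbi (aestronglyMeasurable_kernel α p hP hv x) ?_
    filter_upwards [ae_restrict_mem measurableSet_Ioi] with y hy using hle y hy
  refine ⟨hint, (setIntegral_mono_on hint.norm hbi measurableSet_Ioi fun y hy => hle y hy).trans
    (le_of_eq ?_)⟩
  rw [integral_const_mul, integral_mul_tail_pow h0 hm, Nat.factorial_succ, mul_pow]
  push_cast
  field_simp

theorem volterraOp_bound {α : ℂ} (hα : 0 ≤ α.re) (p : E →L[ℂ] E)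
    (hP : ∀ x, IntegrableOn P (Ioi x)) (hv : Continuous v) {B C : ℝ}
    (hC : ‖1 - p‖ + ‖p‖ ≤ C) {n : ℕ} {x : ℝ}
    (hB : ∀ y, x < y → ‖v y‖ ≤ B * ((C * tail (fun y => ‖P y‖) y) ^ n / n.factorial)) :
    ‖volterraOp α p P v x‖ ≤
      B * ((C * tail (fun y => ‖P y‖) x) ^ (n + 1) / (n + 1).factorial) := by
  rw [volterraOp, norm_neg]
  exact (norm_integral_le_integral_norm _).trans (integral_norm_kernel_le hα p hP hv hC hB).2

theorem continuous_volterraOp {α : ℂ} (hα : 0 ≤ α.re) (p : E →L[ℂ] E)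
    (hP : ∀ x, IntegrableOn P (Ioi x)) (hv : Continuous v)
    (hPv : ∀ x, IntegrableOn (fun y => P y (v y)) (Ioi x)) :
    Continuous (volterraOp α p P v) := by
  refine Continuous.neg (continuous_iff_continuousAt.2 fun x₀ => ?_)
  -- As an integral over the whole line, the integrand jumps at `y = x` only.
  have hrw : (fun x => ∫ y in Ioi x, propagator α p (y - x) (P y (v y))) =
      fun x => ∫ y, (Ioi x).indicator (fun y => propagator α p (y - x) (P y (v y))) y := by
    funext x; rw [integral_indicator measurableSet_Ioi]
  rw [hrw]
  refine continuousAt_of_dominated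
    (bound := (Ioi (x₀ - 1)).indicator fun y => (‖1 - p‖ + ‖p‖) * ‖P y (v y)‖) ?_ ?_ ?_ ?_
  · exact Eventually.of_forall fun x =>
      (aestronglyMeasurable_indicator_iff measurableSet_Ioi).2
        (aestronglyMeasurable_kernel α p hP hv x)
  · filter_upwards [Ioi_mem_nhds (sub_one_lt x₀)] with x hx
    refine Eventually.of_forall fun y => ?_
    by_cases hy : x < y
    · rw [indicator_of_mem (mem_Ioi.2 hy), indicator_of_mem (mem_Ioi.2 (lt_trans hx hy))]
      exact norm_propagator_apply_le hα p le_rfl hy _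
    · rw [indicator_of_notMem (by simpa using hy), norm_zero]
      exact indicator_nonneg (fun y _ => by positivity) y
  · exact (integrable_indicator_iff measurableSet_Ioi).2 ((hPv _).norm.const_mul _)
  · have hne : ∀ᵐ y : ℝ, y ≠ x₀ := by simp [ae_iff, measure_singleton]
    filter_upwards [hne] with y hy
    have hc : Continuous fun x => propagator α p (y - x) (P y (v y)) :=
      ((continuous_propagator α p).comp (continuous_const.sub continuous_id)).clm_apply
        continuous_const
    rcases lt_or_gt_of_ne hy with h | h
    · refine (continuousAt_const (y := (0 : E))).congr ?_
      filter_upwards [Ioi_mem_nhds h] with x hx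
      rw [indicator_of_notMem (by simpa using le_of_lt hx)]
    · refine hc.continuousAt.congr ?_
      filter_upwards [Iio_mem_nhds h] with x hx
      rw [indicator_of_mem (by simpa using hx)]

theorem exists_bound_of_tendsto_atTop {E : Type*} [NormedAddCommGroup E] {v : ℝ → E} {b : E}
    (hv : Continuous v) (hlim : Tendsto v atTop (𝓝 b))
    (a : ℝ) : ∃ B, ∀ y, a < y → ‖v y‖ ≤ B := by
  obtain ⟨N, hN⟩ := eventually_atTop.1 (hlim.norm.eventually (gt_mem_nhds (lt_add_one ‖b‖)))
  obtain ⟨B, hB⟩ := (isCompact_Icc (a := a) (b := N)).exists_bound_of_continuousOn hv.continuousOn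
  refine ⟨max B (‖b‖ + 1), fun y hy => ?_⟩
  rcases le_total y N with h | h
  · exact (hB y ⟨hy.le, h⟩).trans (le_max_left _ _)
  · exact (hN y h).le.trans (le_max_right _ _)

/-- A solution may be unbounded towards `-∞`; the limit at `+∞` makes it bounded on right half-lines,
which is all that the iteration of the estimate uses. -/
theorem IsVolterraSol.unique {α : ℂ} (hα : 0 ≤ α.re) {p : E →L[ℂ] E}
    (hP : ∀ x, IntegrableOn P (Ioi x)) {b : E} {w : ℝ → E}
    (hv : IsVolterraSol α p P b v) (hw : IsVolterraSol α p P b w) : v = w := by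
  have hd : Continuous (v - w) := hv.1.sub hw.1
  have hlim : Tendsto (v - w) atTop (𝓝 (b - b)) := hv.2.1.sub hw.2.1
  have heq : ∀ x, (v - w) x = volterraOp α p P (v - w) x := by
    intro x
    simp only [volterraOp, Pi.sub_apply, map_sub]
    rw [integral_sub (hv.2.2 x).1 (hw.2.2 x).1]
    nth_rewrite 1 [(hv.2.2 x).2, (hw.2.2 x).2]
    abel
  funext x
  obtain ⟨B, hB⟩ := exists_bound_of_tendsto_atTop hd hlim (x - 1)
  have hn : ∀ n : ℕ, ∀ y, x - 1 < y → ‖(v - w) y‖ ≤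
      B * (((‖1 - p‖ + ‖p‖) * tail (fun y => ‖P y‖) y) ^ n / n.factorial) := by
    intro n
    induction n with
    | zero => simpa using hB
    | succ n ih =>
      intro y hy
      rw [heq]
      exact volterraOp_bound hα p hP hd le_rfl fun u hu => ih u (hy.trans hu)
  have hzero : ‖(v - w) x‖ ≤ B * 0 :=
    ge_of_tendsto ((FloorSemiring.tendsto_pow_div_factorial_atTop _).const_mul B)
      (Eventually.of_forall fun n => hn n x (sub_one_lt x))
  rw [mul_zero, norm_le_zero_iff] at hzero
  exact sub_eq_zero.1 hzero

/-- The terms of the Neumann series of the Volterra equation. -/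
noncomputable def volterraTerm (α : ℂ) (p : E →L[ℂ] E) (P : ℝ → E →L[ℂ] E) (b : E) :
    ℕ → ℝ → E
  | 0 => fun _ => b
  | n + 1 => volterraOp α p P (volterraTerm α p P b n)

/-- The sum of the Neumann series. -/
noncomputable def volterraSol (α : ℂ) (p : E →L[ℂ] E) (P : ℝ → E →L[ℂ] E) (b : E) (x : ℝ) : E :=
  ∑' n, volterraTerm α p P b n x

/-- The `n`-th term of the Neumann series is at most `B (C M(x))ⁿ / n!`, where `M` is the tail of
`‖P‖`. -/
theorem volterraTerm_bound {α : ℂ} (hα : 0 ≤ α.re) (p : E →L[ℂ] E)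
    (hP : ∀ x, IntegrableOn P (Ioi x)) {b : E} {B C : ℝ} (hb : ‖b‖ ≤ B)
    (hC : ‖1 - p‖ + ‖p‖ ≤ C) (n : ℕ) :
    Continuous (volterraTerm α p P b n) ∧ ∀ x, ‖volterraTerm α p P b n x‖ ≤
      B * ((C * tail (fun y => ‖P y‖) x) ^ n / n.factorial) := by
  have h0 : ∀ y, 0 ≤ ‖P y‖ := fun y => norm_nonneg _
  have hm : ∀ x, IntegrableOn (fun y => ‖P y‖) (Ioi x) := fun x => (hP x).norm
  have hC0 : 0 ≤ C := (add_nonneg (norm_nonneg _) (norm_nonneg _)).trans hC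
  have hB0 : 0 ≤ B := (norm_nonneg _).trans hb
  induction n with
  | zero => exact ⟨continuous_const, fun x => by simpa [volterraTerm] using hb⟩
  | succ n ih =>
    refine ⟨continuous_volterraOp hα p hP ih.1 fun x => ?_, fun x =>
      volterraOp_bound hα p hP ih.1 hC fun y _ => ih.2 y⟩
    refine integrableOn_apply hP ih.1
      (B := B * ((C * tail (fun y => ‖P y‖) x) ^ n / n.factorial)) fun y hy => (ih.2 y).trans ?_
    have := tail_antitone h0 hm hy.le
    have := tail_nonneg h0 y
    gcongr

theorem summable_volterra_bound (B c : ℝ) :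
    Summable fun n : ℕ => B * (c ^ n / n.factorial) :=
  (Real.summable_pow_div_factorial c).mul_left B

variable [CompleteSpace E]

/-- The Neumann series converges to a solution of the Volterra equation, whatever the size of
`P`. -/
theorem isVolterraSol_volterraSol {α : ℂ} (hα : 0 ≤ α.re) (p : E →L[ℂ] E)
    (hP : ∀ x, IntegrableOn P (Ioi x)) (b : E) :
    IsVolterraSol α p P b (volterraSol α p P b) := by
  set m : ℝ → ℝ := fun y => ‖P y‖ with hm_def
  set C := ‖1 - p‖ + ‖p‖ with hC
  have h0 : ∀ y, 0 ≤ m y := fun y => norm_nonneg _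
  have hm : ∀ x, IntegrableOn m (Ioi x) := fun x => (hP x).norm
  have hC0 : 0 ≤ C := by positivity
  have hbd := volterraTerm_bound hα p hP (le_refl ‖b‖) hC.ge
  have hsum : ∀ x, Summable fun n => volterraTerm α p P b n x := fun x =>
    Summable.of_norm_bounded (summable_volterra_bound ‖b‖ (C * tail m x)) fun n => (hbd n).2 x
  -- On a half-line `x ≥ a` the series is dominated by its values at `a`.
  have hbda : ∀ a x, a ≤ x → ∀ n, ‖volterraTerm α p P b n x‖ ≤
      ‖b‖ * ((C * tail m a) ^ n / n.factorial) := by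
    intro a x hx n
    refine ((hbd n).2 x).trans ?_
    have := tail_antitone h0 hm hx
    have := tail_nonneg h0 x
    gcongr
  have hcont : Continuous (volterraSol α p P b) := by
    refine continuous_iff_continuousAt.2 fun x => ?_
    have : ContinuousOn (volterraSol α p P b) (Ioi (x - 1)) :=
      continuousOn_tsum (fun n => (hbd n).1.continuousOn)
        (summable_volterra_bound ‖b‖ (C * tail m (x - 1)))
        fun n y hy => hbda _ y (le_of_lt hy) n
    exact this.continuousAt (Ioi_mem_nhds (sub_one_lt x))
  have hsolbd : ∀ a x, a ≤ x → ‖volterraSol α p P b x‖ ≤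
      ∑' n : ℕ, ‖b‖ * ((C * tail m a) ^ n / n.factorial) := fun a x hx =>
    tsum_of_norm_bounded (summable_volterra_bound ‖b‖ (C * tail m a)).hasSum (hbda a x hx)
  have hker : ∀ x, IntegrableOn
      (fun y => propagator α p (y - x) (P y (volterraSol α p P b y))) (Ioi x) := fun x =>
    integrableOn_kernel hα p hP hcont
      (integrableOn_apply hP hcont fun y hy => hsolbd x y (le_of_lt hy))
  have heq : ∀ x, volterraSol α p P b x =
      b - ∫ y in Ioi x, propagator α p (y - x) (P y (volterraSol α p P b y)) := by
    intro x
    have hstep := fun n => integral_norm_kernel_le hα p hP (hbd n).1 hC.ge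
      (fun y (_ : x < y) => (hbd n).2 y)
    have hs := hasSum_integral_of_summable_integral_norm (μ := volume.restrict (Ioi x))
      (F := fun n y => propagator α p (y - x) (P y (volterraTerm α p P b n y)))
      (fun n => (hstep n).1)
      (Summable.of_nonneg_of_le (fun n => integral_nonneg fun _ => norm_nonneg _)
        (fun n => (hstep n).2)
        ((summable_nat_add_iff 1).2 (summable_volterra_bound ‖b‖ (C * tail m x))))
    have hin : ∀ y, ∑' n, propagator α p (y - x) (P y (volterraTerm α p P b n y)) =
        propagator α p (y - x) (P y (volterraSol α p P b y)) := by
      intro y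
      exact (((propagator α p (y - x)).comp (P y)).map_tsum (hsum y)).symm
    simp only [hin] at hs
    rw [volterraSol, (hsum x).tsum_eq_zero_add, sub_eq_add_neg, ← hs.neg.tsum_eq]
    rfl
  refine ⟨hcont, ?_, fun x => ⟨hker x, heq x⟩⟩
  rw [tendsto_iff_norm_sub_tendsto_zero]
  set K := ∑' n : ℕ, ‖b‖ * ((C * tail m 0) ^ n / n.factorial) with hK
  refine squeeze_zero' (g := fun x => K * ((C * tail m x) ^ (0 + 1) / (0 + 1).factorial))
    (Eventually.of_forall fun _ => norm_nonneg _) ?_ ?_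
  · filter_upwards [eventually_ge_atTop 0] with x hx
    have h := volterraOp_bound (v := volterraSol α p P b) hα p hP hcont hC.ge (n := 0) (B := K)
      (x := x) (fun y hy => by simpa using hsolbd 0 y (hx.trans hy.le))
    rw [volterraOp, norm_neg] at h
    rw [heq x, sub_sub_cancel_left, norm_neg]
    exact h
  · simpa using ((tendsto_tail hm).const_mul C).const_mul K

end Volterra

/-! ### Dependence on the parameter -/

section Parameter

variable {E : Type*} [NormedAddCommGroup E] [NormedSpace ℂ E]

/-- An integral of holomorphic functions dominated by an integrable function is holomorphic: the
bound on the derivatives comes from Cauchy's estimate. -/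
theorem differentiableOn_integral_of_dominated {μ : Measure ℝ} {U : Set ℂ} (hU : IsOpen U)
    {F : ℂ → ℝ → E} {bound : ℝ → ℝ}
    (hmeas : ∀ z ∈ U, AEStronglyMeasurable (F z) μ)
    (hbound : ∀ᵐ y ∂μ, ∀ z ∈ U, ‖F z y‖ ≤ bound y) (hint : Integrable bound μ)
    (hdiff : ∀ y, DifferentiableOn ℂ (fun z => F z y) U) :
    DifferentiableOn ℂ (fun z => ∫ y, F z y ∂μ) U := by
  intro z₀ hz₀
  obtain ⟨ε, hε, hball⟩ := Metric.isOpen_iff.1 hU z₀ hz₀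
  set r := ε / 3 with hr
  have hr0 : 0 < r := by positivity
  have hsub : ∀ z ∈ Metric.ball z₀ r, Metric.closedBall z r ⊆ U := by
    intro z hz w hw
    apply hball
    rw [Metric.mem_ball] at hz ⊢
    rw [Metric.mem_closedBall] at hw
    linarith [dist_triangle w z z₀]
  have hsubU : Metric.ball z₀ r ⊆ U := fun z hz =>
    hsub z hz (Metric.mem_closedBall_self hr0.le)
  have hderiv : ∀ y, ∀ z ∈ U, HasDerivAt (fun z => F z y) (deriv (fun z => F z y) z) z :=
    fun y z hz => ((hdiff y).differentiableAt (hU.mem_nhds hz)).hasDerivAt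
  have hmeas' : AEStronglyMeasurable (fun y => deriv (fun z => F z y) z₀) μ := by
    -- The derivative is the limit of difference quotients along `z₀ + r / (n + 2)`.
    set c : ℕ → ℂ := fun n => z₀ + ((r / (n + 2) : ℝ) : ℂ) with hc
    have hpos : ∀ n : ℕ, 0 < r / ((n : ℝ) + 2) := fun n => by positivity
    have hcU : ∀ n, c n ∈ U := by
      intro n
      apply hsubU
      rw [Metric.mem_ball, dist_eq_norm, hc, add_sub_cancel_left, Complex.norm_real,
        Real.norm_of_nonneg (hpos n).le]
      rw [div_lt_iff₀ (by positivity)]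
      nlinarith [(Nat.cast_nonneg n : (0 : ℝ) ≤ n)]
    have hclim : Tendsto c atTop (𝓝[≠] z₀) := by
      refine tendsto_nhdsWithin_iff.2 ⟨?_, Eventually.of_forall fun n => ?_⟩
      · have h1 : Tendsto (fun n : ℕ => r / ((n : ℝ) + 2)) atTop (𝓝 0) :=
          Tendsto.div_atTop tendsto_const_nhds
            (tendsto_atTop_add_const_right _ _ tendsto_natCast_atTop_atTop)
        have h2 := (Complex.continuous_ofReal.tendsto 0).comp h1
        simpa [hc, Function.comp_def] using h2.const_add z₀
      · have : ((r / ((n : ℝ) + 2) : ℝ) : ℂ) ≠ 0 := Complex.ofReal_ne_zero.2 (hpos n).ne'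
        simpa [hc] using this
    refine aestronglyMeasurable_of_tendsto_ae atTop
      (f := fun n y => slope (fun z => F z y) z₀ (c n)) (fun n => ?_)
      (Eventually.of_forall fun y => ?_)
    · simp only [slope, vsub_eq_sub]
      exact ((hmeas _ (hcU n)).sub (hmeas _ hz₀)).const_smul _
    · exact (hasDerivAt_iff_tendsto_slope.1 (hderiv y z₀ hz₀)).comp hclim
  refine (hasDerivAt_integral_of_dominated_loc_of_deriv_le (Metric.ball_mem_nhds z₀ hr0)
    (bound := fun y => bound y / r) (F' := fun z y => deriv (fun z => F z y) z)
    ?_ ?_ hmeas' ?_ (hint.div_const r) ?_).2.differentiableAt.differentiableWithinAt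
  · filter_upwards [hU.mem_nhds hz₀] with z hz using hmeas z hz
  · exact hint.mono' (hmeas z₀ hz₀) (hbound.mono fun y hy => hy z₀ hz₀)
  · filter_upwards [hbound] with y hy z hz
    refine Complex.norm_deriv_le_of_forall_mem_sphere_norm_le hr0 ?_ fun w hw =>
      hy w (hsub z hz (Metric.sphere_subset_closedBall hw))
    exact DifferentiableOn.diffContOnCl ((hdiff y).mono
      (by rw [closure_ball z hr0.ne']; exact hsub z hz))
  · exact Eventually.of_forall fun y z hz => hderiv y z (hsubU hz)

variable {P : ℝ → E →L[ℂ] E} {α : ℂ → ℂ} {p : ℂ → E →L[ℂ] E} {b : ℂ → E} {U : Set ℂ}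

theorem continuousOn_volterraTerm {B C : ℝ} (hP : ∀ x, IntegrableOn P (Ioi x))
    (hre : ∀ z ∈ U, 0 ≤ (α z).re) (hb : ∀ z ∈ U, ‖b z‖ ≤ B)
    (hC : ∀ z ∈ U, ‖1 - p z‖ + ‖p z‖ ≤ C)
    (hαc : ContinuousOn α U) (hpc : ContinuousOn p U) (hbc : ContinuousOn b U) (n : ℕ) (x : ℝ) :
    ContinuousOn (fun z => volterraTerm (α z) (p z) P (b z) n x) U := by
  induction n generalizing x with
  | zero => exact hbc
  | succ n ih =>
    refine ContinuousOn.neg fun z₀ hz₀ => ?_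
    refine continuousWithinAt_of_dominated
      (bound := fun y => B * C ^ (n + 1) / n.factorial * (‖P y‖ * tail (fun y => ‖P y‖) y ^ n))
      ?_ ?_ ((integrableOn_mul_tail_pow (fun y => norm_nonneg _) (fun x => (hP x).norm) n
        x).const_mul _) ?_
    · filter_upwards [self_mem_nhdsWithin] with z hz
      exact aestronglyMeasurable_kernel _ _ hP
        (volterraTerm_bound (hre z hz) _ hP (hb z hz) (hC z hz) n).1 x
    · filter_upwards [self_mem_nhdsWithin] with z hz
      filter_upwards [ae_restrict_mem measurableSet_Ioi] with y hy
      exact norm_kernel_le (hre z hz) (hC z hz) hy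
        ((volterraTerm_bound (hre z hz) _ hP (hb z hz) (hC z hz) n).2 y)
    · refine Eventually.of_forall fun y => ?_
      have h : ContinuousOn (fun z => propagator (α z) (p z) (y - x)
          (P y (volterraTerm (α z) (p z) P (b z) n y))) U := by
        unfold propagator
        have := ih y
        fun_prop
      exact h z₀ hz₀

theorem differentiableOn_volterraTerm {B C : ℝ} (hU : IsOpen U)
    (hP : ∀ x, IntegrableOn P (Ioi x))
    (hre : ∀ z ∈ U, 0 ≤ (α z).re) (hb : ∀ z ∈ U, ‖b z‖ ≤ B)
    (hC : ∀ z ∈ U, ‖1 - p z‖ + ‖p z‖ ≤ C)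
    (hαd : DifferentiableOn ℂ α U) (hpd : DifferentiableOn ℂ p U) (hbd : DifferentiableOn ℂ b U)
    (n : ℕ) (x : ℝ) :
    DifferentiableOn ℂ (fun z => volterraTerm (α z) (p z) P (b z) n x) U := by
  induction n generalizing x with
  | zero => exact hbd
  | succ n ih =>
    refine DifferentiableOn.neg (differentiableOn_integral_of_dominated hU
      (bound := fun y => B * C ^ (n + 1) / n.factorial * (‖P y‖ * tail (fun y => ‖P y‖) y ^ n))
      (fun z hz => aestronglyMeasurable_kernel _ _ hP
        (volterraTerm_bound (hre z hz) _ hP (hb z hz) (hC z hz) n).1 x) ?_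
      ((integrableOn_mul_tail_pow (fun y => norm_nonneg _) (fun x => (hP x).norm) n
        x).const_mul _) fun y => ?_)
    · filter_upwards [ae_restrict_mem measurableSet_Ioi] with y hy z hz
      exact norm_kernel_le (hre z hz) (hC z hz) hy
        ((volterraTerm_bound (hre z hz) _ hP (hb z hz) (hC z hz) n).2 y)
    · unfold propagator
      have := ih y
      have h2 : DifferentiableOn ℂ
          (fun z => P y (volterraTerm (α z) (p z) P (b z) n y)) U :=
        (P y).differentiable.comp_differentiableOn this
      have h3 : DifferentiableOn ℂ (fun z => 1 - p z +
          Complex.exp (-(α z * ((y - x : ℝ) : ℂ))) • p z) U :=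
        (hpd.const_sub 1).add (((hαd.mul_const _).neg.cexp).smul hpd)
      exact h3.clm_apply h2

/-- A function that is continuous on `Ω` is bounded near each of its points. -/
theorem exists_open_bound {F : Type*} [SeminormedAddCommGroup F] {Ω : Set ℂ} {f : ℂ → F}
    (hf : ContinuousOn f Ω) {z₀ : ℂ} (hz₀ : z₀ ∈ Ω) :
    ∃ V, IsOpen V ∧ z₀ ∈ V ∧ ∀ z ∈ V ∩ Ω, ‖f z‖ ≤ ‖f z₀‖ + 1 := by
  have h := (hf z₀ hz₀).norm.eventually (gt_mem_nhds (lt_add_one ‖f z₀‖))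
  obtain ⟨V, hV, hz, hsub⟩ := mem_nhdsWithin.1 h
  exact ⟨V, hV, hz, fun z hz => le_of_lt (hsub hz)⟩

theorem exists_open_bounds {Ω : Set ℂ} (hpc : ContinuousOn p Ω) (hbc : ContinuousOn b Ω) {z₀ : ℂ}
    (hz₀ : z₀ ∈ Ω) : ∃ V, IsOpen V ∧ z₀ ∈ V ∧ ∃ B C : ℝ,
      (∀ z ∈ V ∩ Ω, ‖b z‖ ≤ B) ∧ ∀ z ∈ V ∩ Ω, ‖1 - p z‖ + ‖p z‖ ≤ C := by
  obtain ⟨V₁, h1, hz1, hb⟩ := exists_open_bound hbc hz₀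
  obtain ⟨V₂, h2, hz2, hp⟩ := exists_open_bound hpc hz₀
  obtain ⟨V₃, h3, hz3, hp'⟩ := exists_open_bound (continuousOn_const (c := 1) |>.sub hpc) hz₀
  exact ⟨V₁ ∩ (V₂ ∩ V₃), h1.inter (h2.inter h3), ⟨hz1, hz2, hz3⟩, _, _,
    fun z hz => hb z ⟨hz.1.1, hz.2⟩,
    fun z hz => add_le_add (hp' z ⟨hz.1.2.2, hz.2⟩) (hp z ⟨hz.1.2.1, hz.2⟩)⟩

variable [CompleteSpace E]

theorem continuousOn_volterraSol_of_bound {B C : ℝ} (hP : ∀ x, IntegrableOn P (Ioi x))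
    (hre : ∀ z ∈ U, 0 ≤ (α z).re) (hb : ∀ z ∈ U, ‖b z‖ ≤ B)
    (hC : ∀ z ∈ U, ‖1 - p z‖ + ‖p z‖ ≤ C)
    (hαc : ContinuousOn α U) (hpc : ContinuousOn p U) (hbc : ContinuousOn b U) (x : ℝ) :
    ContinuousOn (fun z => volterraSol (α z) (p z) P (b z) x) U :=
  continuousOn_tsum (fun n => continuousOn_volterraTerm hP hre hb hC hαc hpc hbc n x)
    (summable_volterra_bound B (C * tail (fun y => ‖P y‖) x))
    fun n z hz => (volterraTerm_bound (hre z hz) _ hP (hb z hz) (hC z hz) n).2 x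

/-- The solution of the Volterra equation depends continuously on the parameter. -/
theorem continuousOn_volterraSol (hP : ∀ x, IntegrableOn P (Ioi x))
    (hre : ∀ z ∈ U, 0 ≤ (α z).re)
    (hαc : ContinuousOn α U) (hpc : ContinuousOn p U) (hbc : ContinuousOn b U) (x : ℝ) :
    ContinuousOn (fun z => volterraSol (α z) (p z) P (b z) x) U := by
  intro z₀ hz₀
  obtain ⟨V, hV, hz, B, C, hb, hC⟩ := exists_open_bounds hpc hbc hz₀
  have h := continuousOn_volterraSol_of_bound (U := V ∩ U) hP (fun z hz => hre z hz.2) hb hC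
    (hαc.mono inter_subset_right) (hpc.mono inter_subset_right) (hbc.mono inter_subset_right) x
  exact (h z₀ ⟨hz, hz₀⟩).mono_of_mem_nhdsWithin
    (inter_mem (mem_nhdsWithin_of_mem_nhds (hV.mem_nhds hz)) self_mem_nhdsWithin)

/-- The solution of the Volterra equation depends holomorphically on the parameter. -/
theorem differentiableOn_volterraSol (hU : IsOpen U) (hP : ∀ x, IntegrableOn P (Ioi x))
    (hre : ∀ z ∈ U, 0 ≤ (α z).re)
    (hαd : DifferentiableOn ℂ α U) (hpd : DifferentiableOn ℂ p U) (hbd : DifferentiableOn ℂ b U)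
    (x : ℝ) :
    DifferentiableOn ℂ (fun z => volterraSol (α z) (p z) P (b z) x) U := by
  intro z₀ hz₀
  obtain ⟨V, hV, hz, B, C, hb, hC⟩ :=
    exists_open_bounds hpd.continuousOn hbd.continuousOn hz₀
  have hre' : ∀ z ∈ V ∩ U, 0 ≤ (α z).re := fun z hz => hre z hz.2
  have h : DifferentiableOn ℂ (fun z => volterraSol (α z) (p z) P (b z) x) (V ∩ U) :=
    Complex.differentiableOn_tsum_of_summable_norm
      (summable_volterra_bound B (C * tail (fun y => ‖P y‖) x))
      (fun n => differentiableOn_volterraTerm (hV.inter hU) hP hre' hb hC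
        (hαd.mono inter_subset_right) (hpd.mono inter_subset_right)
        (hbd.mono inter_subset_right) n x) (hV.inter hU)
      fun n z hz => (volterraTerm_bound (hre' z hz) _ hP (hb z hz) (hC z hz) n).2 x
  exact (h.differentiableAt ((hV.inter hU).mem_nhds ⟨hz, hz₀⟩)).differentiableWithinAt

end Parameter

/-! ### Equivalence of the differential and the Volterra equation; reflection -/

section LinearSystem

variable {E : Type*} [NormedAddCommGroup E] [NormedSpace ℂ E]

/-- `v` solves `v' = α p v + P v`, written in integrated form, and has the limit `b` along `l`. -/
def IsLinearSol (l : Filter ℝ) (α : ℂ) (p : E →L[ℂ] E) (P : ℝ → E →L[ℂ] E) (b : E)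
    (v : ℝ → E) : Prop :=
  Continuous v ∧ (∀ x₁ x₂, v x₂ - v x₁ = ∫ y in x₁..x₂, (α • p (v y) + P y (v y))) ∧
  Tendsto v l (𝓝 b)

variable {P : ℝ → E →L[ℂ] E} {v : ℝ → E} {α : ℂ} {p : E →L[ℂ] E} {b : E}

theorem propagator_apply (s : ℝ) (e : E) :
    propagator α p s e = (e - p e) + Complex.exp (-(α * s)) • p e := by
  simp [propagator]

theorem tendsto_exp_smul_zero (hα : 0 ≤ α.re) {w : ℝ → E} (hw : Tendsto w atTop (𝓝 0)) (x : ℝ) :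
    Tendsto (fun c : ℝ => Complex.exp (α * (x - c)) • w c) atTop (𝓝 0) := by
  refine squeeze_zero_norm' ?_ (by simpa using hw.norm)
  filter_upwards [eventually_ge_atTop x] with c hc
  rw [norm_smul, Complex.norm_exp]
  refine mul_le_of_le_one_left (norm_nonneg _) (Real.exp_le_one_iff.2 ?_)
  have : (α * ((x : ℂ) - c)).re = α.re * (x - c) := by
    rw [← Complex.ofReal_sub, Complex.re_mul_ofReal]
  rw [this]
  exact mul_nonpos_of_nonneg_of_nonpos hα (sub_nonpos.2 hc)

theorem integrableOn_apply_of_tendsto (hP : ∀ x, IntegrableOn P (Ioi x)) (hv : Continuous v)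
    (hlim : Tendsto v atTop (𝓝 b)) (x : ℝ) : IntegrableOn (fun y => P y (v y)) (Ioi x) :=
  let ⟨_, hB⟩ := exists_bound_of_tendsto_atTop hv hlim x
  integrableOn_apply hP hv hB

theorem clm_sub_eq_integral [CompleteSpace E] {g : ℝ → E} (A : E →L[ℂ] E)
    (hg : LocallyIntegrable g volume) (hf : ∀ a b, v b - v a = ∫ y in a..b, g y) (x₁ x₂ : ℝ) :
    A (v x₂) - A (v x₁) = ∫ y in x₁..x₂, A (g y) := by
  rw [← map_sub, hf, A.intervalIntegral_comp_comm (intervalIntegrable_of_locallyIntegrable hg _ _)]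

theorem clm_locallyIntegrable {g : ℝ → E} (A : E →L[ℂ] E)
    (hg : LocallyIntegrable g volume) : LocallyIntegrable (fun y => A (g y)) volume :=
  fun x => let ⟨s, hs, hi⟩ := hg x; ⟨s, hs, A.integrable_comp hi⟩

theorem integral_Ioi_sub_eq {g : ℝ → E} (hg : ∀ x, IntegrableOn g (Ioi x)) (x₁ x₂ : ℝ) :
    -(∫ y in Ioi x₂, g y) - -(∫ y in Ioi x₁, g y) = ∫ y in x₁..x₂, g y := by
  rw [← intervalIntegral.integral_Ioi_sub_Ioi' (hg x₁) (hg x₂)]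
  abel

/-- `v` solves the Volterra equation of `v' = α p v + P v` with the limit `b` at `-∞`. -/
def IsVolterraSolBot (α : ℂ) (p : E →L[ℂ] E) (P : ℝ → E →L[ℂ] E) (b : E) (v : ℝ → E) : Prop :=
  Continuous v ∧ Tendsto v atBot (𝓝 b) ∧
  ∀ x, IntegrableOn (fun y => propagator α p (y - x) (P y (v y))) (Iio x) ∧
    v x = b + ∫ y in Iio x, propagator α p (y - x) (P y (v y))

theorem integrableOn_Iio_iff_comp_neg {E : Type*} [NormedAddCommGroup E] {f : ℝ → E} (x : ℝ) :
    IntegrableOn f (Iio (-x)) ↔ IntegrableOn (fun y => f (-y)) (Ioi x) := by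
  have h := (Measure.measurePreserving_neg (volume : Measure ℝ)).integrableOn_comp_preimage
    (Homeomorph.neg ℝ).measurableEmbedding (f := f) (s := Iio (-x))
  rw [← h]
  have : (Neg.neg ⁻¹' Iio (-x) : Set ℝ) = Ioi x := by ext; simp
  rw [this]
  rfl

theorem isVolterraSolBot_iff :
    IsVolterraSolBot α p P b v ↔
      IsVolterraSol (-α) p (fun y => -P (-y)) b (fun x => v (-x)) := by
  have hker : ∀ x y : ℝ, propagator (-α) p (y - x) ((-P (-y)) (v (-y))) =
      -(fun y => propagator α p (y - -x) (P y (v y))) (-y) := by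
    intro x y
    simp only [propagator_apply, neg_apply, map_neg]
    have : -(-α * ((y - x : ℝ) : ℂ)) = -(α * ((-y - -x : ℝ) : ℂ)) := by push_cast; ring
    rw [this]
  have hcont : Continuous v ↔ Continuous fun x => v (-x) :=
    ((Homeomorph.neg ℝ).comp_continuous_iff' (f := v)).symm
  have hlim : Tendsto v atBot (𝓝 b) ↔ Tendsto (fun x => v (-x)) atTop (𝓝 b) := by
    rw [← map_neg_atTop, tendsto_map'_iff]; rfl
  unfold IsVolterraSol IsVolterraSolBot
  rw [hcont, hlim, (Equiv.neg ℝ).forall_congr_left]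
  refine and_congr_right fun _ => and_congr_right fun _ => forall_congr' fun x => ?_
  simp only [hker, Equiv.neg_symm, Equiv.neg_apply]
  rw [integral_neg, integral_comp_neg_Ioi x (fun y => propagator α p (y - -x) (P y (v y))),
    integral_Iic_eq_integral_Iio, sub_neg_eq_add, integrableOn_Iio_iff_comp_neg]
  exact and_congr_left fun _ => (integrable_neg_iff (μ := volume.restrict (Ioi x))).symm

theorem isLinearSol_atBot_iff :
    IsLinearSol atBot α p P b v ↔
      IsLinearSol atTop (-α) p (fun y => -P (-y)) b (fun x => v (-x)) := by
  have hcont : Continuous v ↔ Continuous fun x => v (-x) :=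
    ((Homeomorph.neg ℝ).comp_continuous_iff' (f := v)).symm
  have hlim : Tendsto v atBot (𝓝 b) ↔ Tendsto (fun x => v (-x)) atTop (𝓝 b) := by
    rw [← map_neg_atTop, tendsto_map'_iff]; rfl
  unfold IsLinearSol
  rw [hcont, hlim, (Equiv.neg ℝ).forall_congr_left]
  refine and_congr_right fun _ => and_congr_left fun _ => forall_congr' fun x₁ => ?_
  rw [(Equiv.neg ℝ).forall_congr_left]
  refine forall_congr' fun x₂ => ?_
  have hint : ∫ y in x₁..x₂, (-α • p (v (-y)) + (-P (-y)) (v (-y))) =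
      ∫ y in -x₁..-x₂, (α • p (v y) + P y (v y)) := by
    rw [intervalIntegral.integral_symm (-x₂) (-x₁),
      ← intervalIntegral.integral_comp_neg (fun y => α • p (v y) + P y (v y)),
      ← intervalIntegral.integral_neg]
    refine intervalIntegral.integral_congr fun y _ => ?_
    simp only [neg_apply, neg_smul]
    abel
  rw [hint]
  rfl

theorem integrableOn_neg_comp_neg (hP : ∀ x, IntegrableOn P (Iio x)) (x : ℝ) :
    IntegrableOn (fun y => -P (-y)) (Ioi x) :=
  ((integrableOn_Iio_iff_comp_neg x).1 (hP (-x))).neg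

theorem IsVolterraSolBot.unique (hα : α.re ≤ 0) (hP : ∀ x, IntegrableOn P (Iio x)) {w : ℝ → E}
    (hv : IsVolterraSolBot α p P b v) (hw : IsVolterraSolBot α p P b w) : v = w := by
  have h := (isVolterraSolBot_iff.1 hv).unique (by simpa using hα)
    (integrableOn_neg_comp_neg hP) (isVolterraSolBot_iff.1 hw)
  funext x
  simpa using congrFun h (-x)

variable [CompleteSpace E]

/-- Variation of constants: on the kernel of `p` the equation is integrated directly, on the range of
`p` after multiplication by `e^{-αx}`. -/
theorem IsLinearSol.isVolterraSol (hα : 0 ≤ α.re) (hp : ∀ e, p (p e) = p e) (hb : p b = 0)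
    (hP : ∀ x, IntegrableOn P (Ioi x)) (hv : IsLinearSol atTop α p P b v) :
    IsVolterraSol α p P b v := by
  obtain ⟨hc, hode, hlim⟩ := hv
  have hPv := integrableOn_apply_of_tendsto hP hc hlim
  have hPvloc := locallyIntegrable_of_integrableOn_Ioi hPv
  have hker := fun x => integrableOn_kernel hα p hP hc (hPv x)
  refine ⟨hc, hlim, fun x => ⟨hker x, ?_⟩⟩
  have hloc : LocallyIntegrable (fun y => α • p (v y) + P y (v y)) volume :=
    (((p.continuous.comp hc).const_smul α).locallyIntegrable).add hPvloc
  -- Variation of constants on `[x, c]`. As `c → ∞`, the boundary term tends to `b - p b = b`.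
  have hsplit : ∀ c : ℝ, v x =
      ((v c - p (v c)) + Complex.exp (α * (x - c)) • p (v c)) -
        ∫ y in x..c, propagator α p (y - x) (P y (v y)) := by
    intro c
    have h1 : (v c - p (v c)) - (v x - p (v x)) =
        ∫ y in x..c, (P y (v y) - p (P y (v y))) := by
      have h := clm_sub_eq_integral (1 - p) hloc hode x c
      simpa [hp] using h
    have h2 := exp_smul_sub_eq_integral (-α) (p.continuous.comp hc)
      (clm_locallyIntegrable p hloc) (clm_sub_eq_integral p hloc hode) x c
    have h3 : Complex.exp (α * (x - c)) • p (v c) - p (v x) =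
        ∫ y in x..c, Complex.exp (-(α * ((y - x : ℝ) : ℂ))) • p (P y (v y)) := by
      have h := congrArg (fun e : E => Complex.exp (α * x) • e) h2
      simp only [smul_sub, ← intervalIntegral.integral_smul, Function.comp_apply] at h
      refine (congrArg₂ (· - ·) ?_ ?_).trans
        (h.trans (intervalIntegral.integral_congr fun y _ => ?_))
      · rw [smul_smul, ← Complex.exp_add]
        congr 2; ring
      · rw [smul_smul, ← Complex.exp_add, neg_mul, add_neg_cancel, Complex.exp_zero, one_smul]
      · simp only [map_add, map_smul, hp, neg_smul, neg_add_cancel_left, smul_smul,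
          ← Complex.exp_add]
        congr 2; push_cast; ring
    have hi1 : IntervalIntegrable (fun y => P y (v y) - p (P y (v y))) volume x c :=
      intervalIntegrable_of_locallyIntegrable (hPvloc.sub (clm_locallyIntegrable p hPvloc)) _ _
    have hi2 : IntervalIntegrable
        (fun y : ℝ => Complex.exp (-(α * ((y - x : ℝ) : ℂ))) • p (P y (v y))) volume x c :=
      intervalIntegrable_of_locallyIntegrable
        ((clm_locallyIntegrable p hPvloc).continuous_smul (by fun_prop)) _ _
    simp only [propagator_apply]
    rw [intervalIntegral.integral_add hi1 hi2, ← h1, ← h3]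
    abel
  have hplim : Tendsto (fun c => p (v c)) atTop (𝓝 0) := by
    simpa [hb, Function.comp_def] using (p.continuous.tendsto b).comp hlim
  have hl := ((hlim.sub hplim).add (tendsto_exp_smul_zero hα hplim x)).sub
    (intervalIntegral_tendsto_integral_Ioi x (hker x) tendsto_id)
  rw [sub_zero, add_zero] at hl
  exact tendsto_nhds_unique (tendsto_const_nhds.congr hsplit) hl

/-- The converse needs no sign of `Re α`: the integrability of the kernel is part of the
hypothesis. -/
theorem IsVolterraSol.isLinearSol (hp : ∀ e, p (p e) = p e) (hb : p b = 0)
    (hP : ∀ x, IntegrableOn P (Ioi x)) (hv : IsVolterraSol α p P b v) :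
    IsLinearSol atTop α p P b v := by
  obtain ⟨hc, hlim, heq⟩ := hv
  have hPv := integrableOn_apply_of_tendsto hP hc hlim
  have hPvloc := locallyIntegrable_of_integrableOn_Ioi hPv
  refine ⟨hc, fun x₁ x₂ => ?_, hlim⟩
  have h1 : ∀ x, v x - p (v x) = b + -∫ y in Ioi x, (P y (v y) - p (P y (v y))) := by
    intro x
    have h := congrArg (fun e => ((1 : E →L[ℂ] E) - p) e) (heq x).2
    rw [map_sub, ← ContinuousLinearMap.integral_comp_comm _ (heq x).1] at h
    simpa [propagator_apply, hp, hb, sub_eq_add_neg] using h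
  -- Applying `p` to the Volterra equation exhibits `e^{-αx} p v` as a primitive.
  have h2 : ∀ x : ℝ, Complex.exp (-α * x) • p (v x) =
      -∫ y in Ioi x, Complex.exp (-α * y) • p (P y (v y)) := by
    intro x
    have h := congrArg (fun e => Complex.exp (-α * x) • p e) (heq x).2
    simp only [map_sub, hb, zero_sub] at h
    rw [h, ← p.integral_comp_comm (heq x).1, smul_neg, ← integral_smul]
    congr 1
    refine integral_congr_ae (Eventually.of_forall fun y => ?_)
    simp only [propagator_apply, map_add, map_sub, map_smul, hp, sub_self, zero_add, smul_smul,
      ← Complex.exp_add]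
    congr 2; push_cast; ring
  have hi2 : ∀ x, IntegrableOn (fun y : ℝ => Complex.exp (-α * y) • p (P y (v y))) (Ioi x) := by
    intro x
    refine ((p.integrable_comp (heq x).1).smul (Complex.exp (-α * x))).congr
      (Eventually.of_forall fun y => ?_)
    simp only [propagator_apply, map_add, map_sub, map_smul, hp, sub_self, zero_add, smul_smul,
      ← Complex.exp_add, Pi.smul_apply]
    congr 2; push_cast; ring
  have hd1 : (v x₂ - p (v x₂)) - (v x₁ - p (v x₁)) =
      ∫ y in x₁..x₂, (P y (v y) - p (P y (v y))) := by
    rw [h1, h1, add_sub_add_left_eq_sub]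
    exact integral_Ioi_sub_eq (fun x => (hPv x).sub (p.integrable_comp (hPv x))) _ _
  have hd2 := exp_smul_sub_eq_integral α
    (f := fun x : ℝ => Complex.exp (-α * x) • p (v x))
    ((by fun_prop : Continuous fun x : ℝ => Complex.exp (-α * x)).smul (p.continuous.comp hc))
    (locallyIntegrable_of_integrableOn_Ioi hi2)
    (fun a b => by rw [h2, h2, integral_Ioi_sub_eq hi2]) x₁ x₂
  have hcancel : ∀ x : ℝ, ∀ e : E, Complex.exp (α * x) • Complex.exp (-α * x) • e = e := by
    intro x e
    rw [smul_smul, ← Complex.exp_add, neg_mul, add_neg_cancel, Complex.exp_zero, one_smul]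
  have hcancel' : ∀ x : ℝ, ∀ e : E,
      Complex.exp (α * x) • α • Complex.exp (-α * x) • e = α • e := by
    intro x e
    rw [smul_comm, hcancel]
  simp only [smul_add, hcancel, hcancel'] at hd2
  have hsum := congrArg₂ (· + ·) hd1 hd2
  rw [← intervalIntegral.integral_add] at hsum
  · have hsub : v x₂ - v x₁ =
        (v x₂ - p (v x₂)) - (v x₁ - p (v x₁)) + (p (v x₂) - p (v x₁)) := by abel
    rw [hsub]
    refine hsum.trans (intervalIntegral.integral_congr fun y _ => ?_)
    change (P y (v y) - p (P y (v y))) + (α • p (v y) + p (P y (v y))) = _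
    abel
  · exact intervalIntegrable_of_locallyIntegrable
      (hPvloc.sub (clm_locallyIntegrable p hPvloc)) _ _
  · exact intervalIntegrable_of_locallyIntegrable
      (((p.continuous.comp hc).const_smul α).locallyIntegrable.add
        (clm_locallyIntegrable p hPvloc)) _ _

theorem isLinearSol_iff_isVolterraSol (hα : 0 ≤ α.re) (hp : ∀ e, p (p e) = p e) (hb : p b = 0)
    (hP : ∀ x, IntegrableOn P (Ioi x)) :
    IsLinearSol atTop α p P b v ↔ IsVolterraSol α p P b v :=
  ⟨fun h => h.isVolterraSol hα hp hb hP, fun h => h.isLinearSol hp hb hP⟩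

theorem isLinearSol_iff_isVolterraSolBot (hα : α.re ≤ 0) (hp : ∀ e, p (p e) = p e)
    (hb : p b = 0) (hP : ∀ x, IntegrableOn P (Iio x)) :
    IsLinearSol atBot α p P b v ↔ IsVolterraSolBot α p P b v := by
  rw [isLinearSol_atBot_iff, isVolterraSolBot_iff]
  exact isLinearSol_iff_isVolterraSol (by simpa using hα) hp hb (integrableOn_neg_comp_neg hP)

end LinearSystem

open KunduEckhaus

/-! ### Multiplication of the unknown by an exponential -/

section ExponentialFactor

variable {E : Type*} [NormedAddCommGroup E] [NormedSpace ℂ E] {A : ℝ → E →L[ℂ] E} {w : ℝ → E}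

theorem locallyIntegrable_clm_apply (hA : LocallyIntegrable A volume) (hw : Continuous w) :
    LocallyIntegrable (fun y => A y (w y)) volume := by
  intro x
  obtain ⟨s, hs, hi⟩ := hA x
  have ht : IsOpen {y | ‖w y‖ < ‖w x‖ + 1} := isOpen_lt hw.norm continuous_const
  refine ⟨s ∩ {y | ‖w y‖ < ‖w x‖ + 1}, inter_mem hs (ht.mem_nhds (lt_add_one ‖w x‖)), ?_⟩
  have hi' : IntegrableOn A (s ∩ {y | ‖w y‖ < ‖w x‖ + 1}) := hi.mono_set inter_subset_left
  refine Integrable.mono' (hi'.norm.mul_const (‖w x‖ + 1))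
    ((isBoundedBilinearMap_apply (𝕜 := ℂ) (E := E) (F := E)).continuous.comp_aestronglyMeasurable
      (hi'.aestronglyMeasurable.prodMk hw.aestronglyMeasurable)) ?_
  filter_upwards [ae_restrict_of_ae_restrict_of_subset inter_subset_right
    (ae_restrict_mem ht.measurableSet)] with y hy
  exact (ContinuousLinearMap.le_opNorm _ _).trans
    (mul_le_mul_of_nonneg_left (le_of_lt hy) (norm_nonneg _))

variable [CompleteSpace E]

theorem exp_smul_isSol (hA : LocallyIntegrable A volume) (hw : Continuous w)
    (h : ∀ a b, w b - w a = ∫ y in a..b, A y (w y)) (β γ : ℂ) (a b : ℝ) :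
    Complex.exp (β * b + γ) • w b - Complex.exp (β * a + γ) • w a =
      ∫ y in a..b, (β • (Complex.exp (β * y + γ) • w y) +
        A y (Complex.exp (β * y + γ) • w y)) := by
  have h1 := congrArg (fun e : E => Complex.exp γ • e)
    (exp_smul_sub_eq_integral β hw (locallyIntegrable_clm_apply hA hw) h a b)
  simp only [smul_sub, ← intervalIntegral.integral_smul] at h1
  have hexp : ∀ x : ℝ, ∀ e : E, Complex.exp γ • Complex.exp (β * x) • e =
      Complex.exp (β * x + γ) • e := by
    intro x e
    rw [smul_smul, ← Complex.exp_add, add_comm γ]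
  simp only [hexp] at h1
  rw [h1]
  refine intervalIntegral.integral_congr fun y _ => ?_
  simp only [map_smul, smul_add]
  rw [smul_comm]

/-- Multiplying the unknown by `e^{βx+γ}` adds the constant `β` to the coefficient. -/
theorem exp_smul_isSol_iff (hA : LocallyIntegrable A volume) (hw : Continuous w) (β γ : ℂ) :
    (∀ a b, w b - w a = ∫ y in a..b, A y (w y)) ↔
    ∀ a b : ℝ, Complex.exp (β * b + γ) • w b - Complex.exp (β * a + γ) • w a =
      ∫ y in a..b, (β • (Complex.exp (β * y + γ) • w y) +
        A y (Complex.exp (β * y + γ) • w y)) := by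
  refine ⟨fun h => exp_smul_isSol hA hw h β γ, fun h a b => ?_⟩
  -- The converse is the direct statement for the coefficient `β + A` and the factor `e^{-βx-γ}`.
  have hA' : LocallyIntegrable (fun y => β • (1 : E →L[ℂ] E) + A y) volume :=
    LocallyIntegrable.add (f := fun _ => β • (1 : E →L[ℂ] E)) (locallyIntegrable_const _) hA
  have hw' : Continuous fun y : ℝ => Complex.exp (β * y + γ) • w y := by fun_prop
  have hexp : ∀ x : ℝ, ∀ e : E, Complex.exp (-β * x + -γ) • Complex.exp (β * x + γ) • e = e := by
    intro x e
    rw [smul_smul, ← Complex.exp_add]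
    have : -β * (x : ℂ) + -γ + (β * x + γ) = 0 := by ring
    rw [this, Complex.exp_zero, one_smul]
  have h2 : Complex.exp (-β * b + -γ) • Complex.exp (β * b + γ) • w b -
      Complex.exp (-β * a + -γ) • Complex.exp (β * a + γ) • w a =
      ∫ y in a..b, (-β • Complex.exp (-β * y + -γ) • Complex.exp (β * y + γ) • w y +
        (β • Complex.exp (-β * y + -γ) • Complex.exp (β * y + γ) • w y +
          A y (Complex.exp (-β * y + -γ) • Complex.exp (β * y + γ) • w y))) :=
    exp_smul_isSol hA' hw' h (-β) (-γ) a b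
  simp only [hexp, neg_smul, neg_add_cancel_left] at h2
  exact h2

end ExponentialFactor

/-! ### The asymptotic spectral problem -/

section LaxPair

/-- A `2 × 2` matrix as a continuous linear operator on column vectors. -/
noncomputable def matOp (M : Mat2) : (Fin 2 → ℂ) →L[ℂ] (Fin 2 → ℂ) :=
  LinearMap.toContinuousLinearMap (Matrix.mulVecLin M)

theorem matOp_apply (M : Mat2) (v : Fin 2 → ℂ) : matOp M v = M.mulVec v := rfl

theorem matOp_eq_sum (M : Mat2) : matOp M = ∑ i, ∑ j, M i j • matOp (Matrix.single i j 1) := by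
  ext v k
  fin_cases k <;>
    simp [matOp_apply, Matrix.mulVec, dotProduct, Fin.sum_univ_two, Matrix.single]

/-- The sign `+1` for the first column and `-1` for the second: the `j`-th diagonal entry of
`σ₃`. -/
def colSign (j : Fin 2) : ℂ := if j = 0 then 1 else -1

/-- The diagonal projection onto the coordinate other than the `j`-th. -/
def otherProj (j : Fin 2) : Mat2 := if j = 0 then !![0, 0; 0, 1] else !![1, 0; 0, 0]

/-- The exponential rate `± 2iλ` in the `j`-th column of the Volterra equation. -/
noncomputable def colRate (q0 : ℝ) (j : Fin 2) (z : ℂ) : ℂ := colSign j * (2 * Complex.I * lam q0 z)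

/-- The spectral projection `Y D Y⁻¹` of the asymptotic problem that complements the `j`-th
eigenvector. -/
noncomputable def colProj (qs : ℂ) (j : Fin 2) (z : ℂ) : Mat2 :=
  asymY qs z * otherProj j * (asymY qs z)⁻¹

/-- The points at which the asymptotic problem is regular: away from the origin and the branch
points. -/
def regularSet (q0 : ℝ) : Set ℂ := {z | z ≠ 0 ∧ z ^ 2 + (q0 : ℂ) ^ 2 ≠ 0}

/-- The perturbation `ΔQ` as an operator. -/
noncomputable def deltaQ (q : ℝ → ℝ → ℂ) (qs : ℂ) (t : ℝ) (y : ℝ) :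
    (Fin 2 → ℂ) →L[ℂ] (Fin 2 → ℂ) := matOp (potMat (q y t) - potMat qs)

variable {q0 : ℝ} {q : ℝ → ℝ → ℂ} {qs : ℂ} {t : ℝ} {z : ℂ} {j : Fin 2}

theorem conj_mul_self_eq (hqs : ‖qs‖ = q0) : qs * (starRingEnd ℂ) qs = (q0 : ℂ) ^ 2 := by
  rw [Complex.mul_conj, Complex.normSq_eq_norm_sq, hqs]; norm_cast

theorem asymY_eq (qs z : ℂ) : asymY qs z =
    !![1, -(Complex.I / z * qs); -(Complex.I / z * (starRingEnd ℂ) qs), 1] := by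
  ext i k
  fin_cases i <;> fin_cases k <;>
    simp [asymY, sigma3, potMat]

theorem asymY_det (hqs : ‖qs‖ = q0) (hz : z ∈ regularSet q0) :
    (asymY qs z).det = (z ^ 2 + (q0 : ℂ) ^ 2) / z ^ 2 := by
  have h0 := hz.1
  rw [asymY_eq, Matrix.det_fin_two_of, ← conj_mul_self_eq hqs]
  field_simp
  rw [Complex.I_sq]; ring

theorem asymY_inv (hqs : ‖qs‖ = q0) (hz : z ∈ regularSet q0) : (asymY qs z)⁻¹ =
    (z ^ 2 / (z ^ 2 + (q0 : ℂ) ^ 2)) •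
      !![1, Complex.I / z * qs; Complex.I / z * (starRingEnd ℂ) qs, 1] := by
  rw [Matrix.inv_def, asymY_det hqs hz, asymY_eq, Matrix.adjugate_fin_two_of, Ring.inverse_eq_inv',
    inv_div, neg_neg, neg_neg]

theorem isUnit_asymY_det (hqs : ‖qs‖ = q0) (hz : z ∈ regularSet q0) :
    IsUnit (asymY qs z).det := by
  rw [asymY_det hqs hz]
  exact (div_ne_zero hz.2 (pow_ne_zero 2 hz.1)).isUnit

theorem otherProj_sq (j : Fin 2) : otherProj j * otherProj j = otherProj j := by
  ext i k
  fin_cases j <;> fin_cases i <;> fin_cases k <;> simp [otherProj]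

theorem colProj_sq (hqs : ‖qs‖ = q0) (hz : z ∈ regularSet q0) :
    colProj qs j z * colProj qs j z = colProj qs j z := by
  have h := Matrix.nonsing_inv_mul _ (isUnit_asymY_det hqs hz)
  calc _ = asymY qs z * otherProj j * ((asymY qs z)⁻¹ * asymY qs z) * otherProj j *
        (asymY qs z)⁻¹ := by simp only [colProj, Matrix.mul_assoc]
    _ = _ := by
      rw [h, Matrix.mul_one, Matrix.mul_assoc (asymY qs z) (otherProj j), otherProj_sq, colProj]

theorem matOp_colProj_idem (hqs : ‖qs‖ = q0) (hz : z ∈ regularSet q0) (e : Fin 2 → ℂ) :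
    matOp (colProj qs j z) (matOp (colProj qs j z) e) = matOp (colProj qs j z) e := by
  simp only [matOp_apply, Matrix.mulVec_mulVec, colProj_sq hqs hz]

theorem matOp_colProj_col (hqs : ‖qs‖ = q0) (hz : z ∈ regularSet q0) :
    matOp (colProj qs j z) ((asymY qs z).col j) = 0 := by
  have h := Matrix.nonsing_inv_mul _ (isUnit_asymY_det hqs hz)
  have hcol : (asymY qs z).col j = (asymY qs z).mulVec (Pi.single j 1) := by
    simp
  rw [hcol, matOp_apply, Matrix.mulVec_mulVec, colProj, Matrix.mul_assoc, h, Matrix.mul_one,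
    ← Matrix.mulVec_mulVec]
  have : (otherProj j).mulVec (Pi.single j 1) = 0 := by
    ext i; fin_cases j <;> fin_cases i <;> simp [otherProj, Matrix.mulVec, dotProduct]
  rw [this, Matrix.mulVec_zero]

/-- The conjugated exponentials of the Volterra kernel are the propagator of the spectral
projection. -/
theorem smul_volterraLeft_mulVec (hqs : ‖qs‖ = q0) (hz : z ∈ regularSet q0) (x y : ℝ)
    (e : Fin 2 → ℂ) :
    volterraRight q0 z x y j j • (volterraLeft q0 q qs t z x y).mulVec e =
      propagator (colRate q0 j z) (matOp (colProj qs j z)) (y - x) (deltaQ q qs t y e) := by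
  have hinv := Matrix.mul_nonsing_inv _ (isUnit_asymY_det hqs hz)
  have hdiag : volterraRight q0 z x y j j •
      expSigma3 (-(Complex.I * lam q0 z * ((x : ℂ) - (y : ℂ)))) =
      (1 - otherProj j) + Complex.exp (-(colRate q0 j z * ((y - x : ℝ) : ℂ))) • otherProj j := by
    set a := Complex.I * lam q0 z * ((x : ℂ) - (y : ℂ)) with ha
    have h1 : -(colRate q0 0 z * ((y : ℂ) - x)) = a + a := by
      simp only [colRate, colSign, ha]; simp; ring
    have h2 : -(colRate q0 1 z * ((y : ℂ) - x)) = -a + -a := by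
      simp only [colRate, colSign, ha]; simp; ring
    ext i k
    fin_cases j <;> fin_cases i <;> fin_cases k <;>
      simp [volterraRight, expSigma3, otherProj, h1, h2, ← ha, ← Complex.exp_add]
  have hmat : volterraRight q0 z x y j j • volterraLeft q0 q qs t z x y =
      ((1 - colProj qs j z) + Complex.exp (-(colRate q0 j z * ((y - x : ℝ) : ℂ))) •
        colProj qs j z) * (potMat (q y t) - potMat qs) := by
    rw [volterraLeft, ← Matrix.smul_mul, ← Matrix.smul_mul, ← Matrix.mul_smul, hdiag]
    congr 1
    rw [Matrix.mul_add, Matrix.add_mul, Matrix.mul_sub, Matrix.sub_mul, Matrix.mul_one, hinv,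
      Matrix.mul_smul, Matrix.smul_mul, colProj]
  rw [← Matrix.smul_mulVec, hmat, ← Matrix.mulVec_mulVec, propagator_apply, Matrix.add_mulVec,
    Matrix.sub_mulVec, Matrix.one_mulVec, Matrix.smul_mulVec]
  rfl

/-- The columns of `Y` are eigenvectors of the asymptotic matrix, with eigenvalues `∓ iλ`. -/
theorem asymptotic_mul_asymY (hqs : ‖qs‖ = q0) (hz : z ∈ regularSet q0) :
    ((-Complex.I * kOf q0 z) • sigma3 + potMat qs) * asymY qs z =
      asymY qs z * ((-Complex.I * lam q0 z) • sigma3) := by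
  have h0 := hz.1
  have hq := conj_mul_self_eq hqs
  have hzi : z * z⁻¹ = 1 := mul_inv_cancel₀ h0
  rw [asymY_eq]
  ext i k
  fin_cases i <;> fin_cases k <;>
    simp [sigma3, potMat, Matrix.mul_apply, Fin.sum_univ_two, kOf, lam, div_eq_mul_inv]
  · linear_combination (-Complex.I * z⁻¹) * hq
  · linear_combination (qs * z * z⁻¹) * Complex.I_sq - qs * hzi
  · linear_combination (-(starRingEnd ℂ) qs * z * z⁻¹) * Complex.I_sq + (starRingEnd ℂ) qs * hzi
  · linear_combination (Complex.I * z⁻¹) * hq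

theorem laxX_add_eq (hqs : ‖qs‖ = q0) (hz : z ∈ regularSet q0) (y : ℝ) :
    (colSign j * (Complex.I * lam q0 z)) • (1 : Mat2) + laxX q0 q y t z =
      colRate q0 j z • colProj qs j z + (potMat (q y t) - potMat qs) := by
  have hinv := Matrix.mul_nonsing_inv _ (isUnit_asymY_det hqs hz)
  have hX : (-Complex.I * kOf q0 z) • sigma3 + potMat qs =
      asymY qs z * ((-Complex.I * lam q0 z) • sigma3) * (asymY qs z)⁻¹ := by
    rw [← asymptotic_mul_asymY hqs hz, Matrix.mul_assoc, hinv, Matrix.mul_one]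
  have hD : (colSign j * (Complex.I * lam q0 z)) • (1 : Mat2) + (-Complex.I * lam q0 z) • sigma3 =
      colRate q0 j z • otherProj j := by
    ext i k
    fin_cases j <;> fin_cases i <;> fin_cases k <;>
      simp [colSign, colRate, otherProj, sigma3] <;> ring
  have h1 : (colSign j * (Complex.I * lam q0 z)) • (1 : Mat2) =
      asymY qs z * ((colSign j * (Complex.I * lam q0 z)) • (1 : Mat2)) * (asymY qs z)⁻¹ := by
    rw [Matrix.mul_smul, Matrix.mul_one, Matrix.smul_mul, hinv]
  have h2 : laxX q0 q y t z = ((-Complex.I * kOf q0 z) • sigma3 + potMat qs) +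
      (potMat (q y t) - potMat qs) := by
    rw [laxX]; abel
  rw [h2, ← add_assoc, hX, h1, ← Matrix.add_mul, ← Matrix.mul_add, hD, Matrix.mul_smul,
    Matrix.smul_mul, colProj]

theorem deltaQ_eq (y : ℝ) : deltaQ q qs t y =
    (q y t - qs) • matOp !![0, 1; 0, 0] + (starRingEnd ℂ) (q y t - qs) • matOp !![0, 0; -1, 0] := by
  ext v k
  fin_cases k <;> simp [deltaQ, matOp_apply, potMat, Matrix.mulVec, dotProduct, Fin.sum_univ_two]
  ring

theorem integrable_smul_add_conj_smul {F : Type*} [NormedAddCommGroup F] [NormedSpace ℂ F]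
    {μ : Measure ℝ} {f : ℝ → ℂ} (hf : Integrable f μ) (A B : F) :
    Integrable (fun x => f x • A + (starRingEnd ℂ) (f x) • B) μ := by
  have h1 : Integrable (fun x => (starRingEnd ℂ) (f x)) μ :=
    (Complex.conjCLE.toContinuousLinearMap).integrable_comp hf
  exact (hf.smul_const A).add (h1.smul_const B)

theorem integrableOn_deltaQ {s : Set ℝ} (h : IntegrableOn (fun x => q x t - qs) s) :
    IntegrableOn (deltaQ q qs t) s := by
  rw [show deltaQ q qs t = _ from funext deltaQ_eq]
  exact integrable_smul_add_conj_smul h _ _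

end LaxPair

/-! ### The columns as solutions of the general equations -/

section Columns

variable {q0 : ℝ} {q : ℝ → ℝ → ℂ} {qs : ℂ} {t : ℝ} {z : ℂ} {j : Fin 2}

theorem isModifiedJostColPlus_iff (hqs : ‖qs‖ = q0) (hz : z ∈ regularSet q0)
    {v : ℝ → Fin 2 → ℂ} :
    IsModifiedJostColPlus q0 q qs t j z v ↔
      IsVolterraSol (colRate q0 j z) (matOp (colProj qs j z)) (deltaQ q qs t)
        ((asymY qs z).col j) v := by
  simp only [IsModifiedJostColPlus, IsVolterraSol, smul_volterraLeft_mulVec hqs hz]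

theorem isModifiedJostColMinus_iff (hqs : ‖qs‖ = q0) (hz : z ∈ regularSet q0)
    {v : ℝ → Fin 2 → ℂ} :
    IsModifiedJostColMinus q0 q qs t j z v ↔
      IsVolterraSolBot (colRate q0 j z) (matOp (colProj qs j z)) (deltaQ q qs t)
        ((asymY qs z).col j) v := by
  simp only [IsModifiedJostColMinus, IsVolterraSolBot, smul_volterraLeft_mulVec hqs hz]

theorem expSigma3_apply_self (a : ℂ) (j : Fin 2) :
    expSigma3 a j j = Complex.exp (colSign j * a) := by
  fin_cases j <;> simp [expSigma3, colSign]

theorem matOp_laxX_eq (hqs : ‖qs‖ = q0) (hz : z ∈ regularSet q0) (j : Fin 2) (y : ℝ) :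
    matOp (laxX q0 q y t z) =
      (matOp (colRate q0 j z • colProj qs j z) -
        matOp ((colSign j * (Complex.I * lam q0 z)) • (1 : Mat2))) + deltaQ q qs t y := by
  have h : laxX q0 q y t z = (colRate q0 j z • colProj qs j z -
      (colSign j * (Complex.I * lam q0 z)) • (1 : Mat2)) + (potMat (q y t) - potMat qs) := by
    rw [sub_add_eq_add_sub, ← laxX_add_eq hqs hz, add_sub_cancel_left]
  rw [h]
  ext v k
  simp [matOp_apply, deltaQ, Matrix.add_mulVec, Matrix.sub_mulVec]

theorem locallyIntegrable_const_add {F : Type*} [NormedAddCommGroup F] {f : ℝ → F}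
    (hf : LocallyIntegrable f volume) (c : F) : LocallyIntegrable (fun y => c + f y) volume :=
  (locallyIntegrable_const c).add hf

theorem locallyIntegrable_laxX (hqs : ‖qs‖ = q0) (hz : z ∈ regularSet q0)
    (hQ : LocallyIntegrable (deltaQ q qs t) volume) :
    LocallyIntegrable (fun y => matOp (laxX q0 q y t z)) volume := by
  simp only [matOp_laxX_eq hqs hz 0]
  exact locallyIntegrable_const_add hQ _

/-- Removing the oscillating factor turns a column of a Jost solution into a solution, with a limit,
of the perturbed constant-coefficient system. -/
theorem isJostCol_iff (hqs : ‖qs‖ = q0) (hz : z ∈ regularSet q0)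
    (hQ : LocallyIntegrable (deltaQ q qs t) volume) {l : Filter ℝ} {w : ℝ → Fin 2 → ℂ} :
    IsJostCol l q0 q qs t j z w ↔
      IsLinearSol l (colRate q0 j z) (matOp (colProj qs j z)) (deltaQ q qs t)
        ((asymY qs z).col j)
        (fun x => expSigma3 (Complex.I * theta q0 x t z) j j • w x) := by
  set β := colSign j * (Complex.I * lam q0 z) with hβ
  set γ := colSign j * (Complex.I * lam q0 z * kOf q0 z * t) with hγ
  have hθ : ∀ x : ℝ, expSigma3 (Complex.I * theta q0 x t z) j j = Complex.exp (β * x + γ) := by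
    intro x
    rw [expSigma3_apply_self, theta, hβ, hγ]
    congr 1; ring
  simp only [IsJostCol, IsLinearSol, hθ]
  have hcont : (Continuous fun x : ℝ => Complex.exp (β * x + γ) • w x) ↔ Continuous w := by
    refine ⟨fun h => ?_, fun h => by fun_prop⟩
    have h2 : w = fun x : ℝ => Complex.exp (-(β * x + γ)) • Complex.exp (β * x + γ) • w x := by
      funext x
      rw [smul_smul, ← Complex.exp_add, neg_add_cancel, Complex.exp_zero, one_smul]
    rw [h2]
    fun_prop
  rw [hcont]
  refine and_congr_right fun hw => and_congr_left fun _ => ?_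
  refine (exp_smul_isSol_iff (locallyIntegrable_laxX hqs hz hQ) hw β γ).trans ?_
  have hcoef : ∀ (y : ℝ) (e : Fin 2 → ℂ), β • e + matOp (laxX q0 q y t z) e =
      colRate q0 j z • matOp (colProj qs j z) e + deltaQ q qs t y e := by
    intro y e
    have h := congrArg (fun M : Mat2 => M.mulVec e)
      (laxX_add_eq (q := q) (t := t) (j := j) hqs hz y)
    simp only [Matrix.add_mulVec, Matrix.smul_mulVec, Matrix.one_mulVec] at h
    exact h
  simp only [hcoef]

end Columns

/-! ### Holomorphic dependence of the coefficients on the spectral parameter -/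

section Regularity

variable {q0 : ℝ} {qs : ℂ} (j : Fin 2)

theorem differentiableOn_inv_regularSet :
    DifferentiableOn ℂ (fun z : ℂ => z⁻¹) (regularSet q0) := fun _ hz =>
  (differentiableAt_inv hz.1).differentiableWithinAt

theorem differentiableOn_lam : DifferentiableOn ℂ (lam q0) (regularSet q0) :=
  ((differentiableOn_id.add (differentiableOn_inv_regularSet.const_mul ((q0 : ℂ) ^ 2))).div_const
    2).congr fun z _ => by simp [lam, div_eq_mul_inv]

theorem differentiableOn_kOf : DifferentiableOn ℂ (kOf q0) (regularSet q0) :=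
  ((differentiableOn_id.sub (differentiableOn_inv_regularSet.const_mul ((q0 : ℂ) ^ 2))).div_const
    2).congr fun z _ => by simp [kOf, div_eq_mul_inv]

theorem differentiableOn_colRate : DifferentiableOn ℂ (colRate q0 j) (regularSet q0) :=
  (differentiableOn_lam.const_mul (2 * Complex.I)).const_mul (colSign j)

theorem differentiableOn_I_div_mul (c : ℂ) :
    DifferentiableOn ℂ (fun z : ℂ => Complex.I / z * c) (regularSet q0) :=
  (differentiableOn_inv_regularSet.const_mul Complex.I).mul_const c

theorem differentiableOn_asymY_apply (i k : Fin 2) :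
    DifferentiableOn ℂ (fun z => asymY qs z i k) (regularSet q0) := by
  simp only [asymY_eq]
  fin_cases i <;> fin_cases k
  · exact differentiableOn_const 1
  · exact (differentiableOn_I_div_mul qs).neg
  · exact (differentiableOn_I_div_mul ((starRingEnd ℂ) qs)).neg
  · exact differentiableOn_const 1

theorem differentiableOn_asymY_col :
    DifferentiableOn ℂ (fun z => (asymY qs z).col j) (regularSet q0) :=
  differentiableOn_pi.2 fun i => differentiableOn_asymY_apply i j

theorem differentiableOn_asymY_inv_apply (hqs : ‖qs‖ = q0) (i k : Fin 2) :
    DifferentiableOn ℂ (fun z => (asymY qs z)⁻¹ i k) (regularSet q0) := by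
  have hfac : DifferentiableOn ℂ (fun z : ℂ => z ^ 2 / (z ^ 2 + (q0 : ℂ) ^ 2))
      (regularSet q0) :=
    (differentiableOn_id.pow 2).div ((differentiableOn_id.pow 2).add_const _) fun _ hz => hz.2
  have hent : DifferentiableOn ℂ (fun z =>
      (!![1, Complex.I / z * qs; Complex.I / z * (starRingEnd ℂ) qs, 1] : Mat2) i k)
      (regularSet q0) := by
    fin_cases i <;> fin_cases k
    · exact differentiableOn_const 1
    · exact differentiableOn_I_div_mul qs
    · exact differentiableOn_I_div_mul ((starRingEnd ℂ) qs)
    · exact differentiableOn_const 1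
  refine (hfac.mul hent).congr fun z hz => ?_
  rw [asymY_inv hqs hz]
  rfl

theorem differentiableOn_colProj_apply (hqs : ‖qs‖ = q0) (i k : Fin 2) :
    DifferentiableOn ℂ (fun z => colProj qs j z i k) (regularSet q0) := by
  simp only [colProj, Matrix.mul_apply]
  exact DifferentiableOn.fun_sum fun m _ => (DifferentiableOn.fun_sum fun n _ =>
    (differentiableOn_asymY_apply i n).mul_const _).mul
      (differentiableOn_asymY_inv_apply hqs m k)

theorem differentiableOn_sum_smul {F : Type*} [NormedAddCommGroup F] [NormedSpace ℂ F] {U : Set ℂ}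
    {f : ℂ → Fin 2 → Fin 2 → ℂ} (hf : ∀ i k, DifferentiableOn ℂ (fun z => f z i k) U)
    (A : Fin 2 → Fin 2 → F) :
    DifferentiableOn ℂ (fun z => ∑ i, ∑ k, f z i k • A i k) U :=
  DifferentiableOn.fun_sum fun i _ => DifferentiableOn.fun_sum fun k _ => (hf i k).smul_const _

theorem differentiableOn_colProj (hqs : ‖qs‖ = q0) :
    DifferentiableOn ℂ (fun z => matOp (colProj qs j z)) (regularSet q0) :=
  (differentiableOn_sum_smul (f := fun z => colProj qs j z)
    (differentiableOn_colProj_apply j hqs) _).congr fun _ _ => matOp_eq_sum _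

theorem differentiableOn_expSigma3_theta (x t : ℝ) :
    DifferentiableOn ℂ (fun z => expSigma3 (-(Complex.I * theta q0 x t z)) j j)
      (regularSet q0) := by
  simp only [expSigma3_apply_self]
  exact ((((differentiableOn_lam.mul ((differentiableOn_kOf.mul_const (t : ℂ)).const_add
    (x : ℂ))).const_mul Complex.I).neg).const_mul (colSign j)).cexp

end Regularity

/-! ### Solutions for single columns -/

section Existence

/-- The `j`-th column of the modified Jost solution normalised at `+∞`. -/
noncomputable def colPlus (q0 : ℝ) (q : ℝ → ℝ → ℂ) (qs : ℂ) (t : ℝ) (j : Fin 2) (x : ℝ) (z : ℂ) :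
    Fin 2 → ℂ :=
  volterraSol (colRate q0 j z) (matOp (colProj qs j z)) (deltaQ q qs t) ((asymY qs z).col j) x

/-- The `j`-th column of the modified Jost solution normalised at `-∞`, obtained from the equation
at `+∞` by the reflection `x ↦ -x`. -/
noncomputable def colMinus (q0 : ℝ) (q : ℝ → ℝ → ℂ) (qs : ℂ) (t : ℝ) (j : Fin 2) (x : ℝ) (z : ℂ) :
    Fin 2 → ℂ :=
  volterraSol (-colRate q0 j z) (matOp (colProj qs j z)) (fun y => -deltaQ q qs t (-y))
    ((asymY qs z).col j) (-x)

variable {q0 : ℝ} {q : ℝ → ℝ → ℂ} {qs : ℂ} {t : ℝ} {j : Fin 2} {D S : Set ℂ}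

theorem isAnalyticSolution_colPlus (hqs : ‖qs‖ = q0)
    (hQ : ∀ x, IntegrableOn (deltaQ q qs t) (Ioi x)) (hD : IsOpen D)
    (hreg : D ∪ S ⊆ regularSet q0) (hre : ∀ z ∈ D ∪ S, 0 ≤ (colRate q0 j z).re) :
    IsAnalyticSolution (IsModifiedJostColPlus q0 q qs t j) D S (colPlus q0 q qs t j) := by
  refine ⟨fun z hz => ?_, fun x => ⟨?_, ?_⟩⟩
  · have hz' := hreg hz
    have hsol := isVolterraSol_volterraSol (hre z hz) (matOp (colProj qs j z)) hQ
      ((asymY qs z).col j)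
    exact ⟨(isModifiedJostColPlus_iff hqs hz').2 hsol, fun g hg =>
      ((isModifiedJostColPlus_iff hqs hz').1 hg).unique (hre z hz) hQ hsol⟩
  · have hD' : D ⊆ regularSet q0 := subset_union_left.trans hreg
    exact (differentiableOn_volterraSol hD hQ (fun z hz => hre z (Or.inl hz))
      ((differentiableOn_colRate j).mono hD') ((differentiableOn_colProj j hqs).mono hD')
      ((differentiableOn_asymY_col j).mono hD') x).analyticOnNhd hD
  · exact continuousOn_volterraSol hQ hre ((differentiableOn_colRate j).continuousOn.mono hreg)
      ((differentiableOn_colProj j hqs).continuousOn.mono hreg)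
      ((differentiableOn_asymY_col j).continuousOn.mono hreg) x

theorem isAnalyticSolution_colMinus (hqs : ‖qs‖ = q0)
    (hQ : ∀ x, IntegrableOn (deltaQ q qs t) (Iio x)) (hD : IsOpen D)
    (hreg : D ∪ S ⊆ regularSet q0) (hre : ∀ z ∈ D ∪ S, (colRate q0 j z).re ≤ 0) :
    IsAnalyticSolution (IsModifiedJostColMinus q0 q qs t j) D S (colMinus q0 q qs t j) := by
  have hQ' := integrableOn_neg_comp_neg hQ
  have hre' : ∀ z ∈ D ∪ S, 0 ≤ (-colRate q0 j z).re := fun z hz => by simpa using hre z hz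
  refine ⟨fun z hz => ?_, fun x => ⟨?_, ?_⟩⟩
  · have hz' := hreg hz
    have hsol : IsVolterraSolBot (colRate q0 j z) (matOp (colProj qs j z)) (deltaQ q qs t)
        ((asymY qs z).col j) (fun x => colMinus q0 q qs t j x z) := by
      rw [isVolterraSolBot_iff]
      simpa only [colMinus, neg_neg] using isVolterraSol_volterraSol (hre' z hz)
        (matOp (colProj qs j z)) hQ' ((asymY qs z).col j)
    exact ⟨(isModifiedJostColMinus_iff hqs hz').2 hsol, fun g hg =>
      ((isModifiedJostColMinus_iff hqs hz').1 hg).unique (hre z hz) hQ hsol⟩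
  · have hD' : D ⊆ regularSet q0 := subset_union_left.trans hreg
    exact (differentiableOn_volterraSol hD hQ' (fun z hz => hre' z (Or.inl hz))
      ((differentiableOn_colRate j).neg.mono hD') ((differentiableOn_colProj j hqs).mono hD')
      ((differentiableOn_asymY_col j).mono hD') (-x)).analyticOnNhd hD
  · exact continuousOn_volterraSol hQ' hre'
      ((differentiableOn_colRate j).neg.continuousOn.mono hreg)
      ((differentiableOn_colProj j hqs).continuousOn.mono hreg)
      ((differentiableOn_asymY_col j).continuousOn.mono hreg) (-x)

theorem expSigma3_neg_smul_smul (a : ℂ) (j : Fin 2) (e : Fin 2 → ℂ) :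
    expSigma3 a j j • expSigma3 (-a) j j • e = e := by
  rw [smul_smul, expSigma3_apply_self, expSigma3_apply_self, ← Complex.exp_add, mul_neg,
    add_neg_cancel, Complex.exp_zero, one_smul]

/-- Unique solvability, analyticity and continuity pass from the modified Jost columns to the Jost
columns. -/
theorem IsAnalyticSolution.jostCol {PU : ℂ → (ℝ → Fin 2 → ℂ) → Prop} {l : Filter ℝ}
    {u : ℝ → ℂ → Fin 2 → ℂ} (hD : IsOpen D) (hreg : D ∪ S ⊆ regularSet q0)
    (hiff : ∀ z ∈ D ∪ S, ∀ w, IsJostCol l q0 q qs t j z w ↔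
      PU z fun x => expSigma3 (Complex.I * theta q0 x t z) j j • w x)
    (hu : IsAnalyticSolution PU D S u) :
    IsAnalyticSolution (IsJostCol l q0 q qs t j) D S
      (fun x z => expSigma3 (-(Complex.I * theta q0 x t z)) j j • u x z) := by
  have hD' : D ⊆ regularSet q0 := subset_union_left.trans hreg
  refine ⟨fun z hz => ⟨?_, fun g hg => ?_⟩, fun x => ⟨?_, ?_⟩⟩
  · rw [hiff z hz]
    simpa only [expSigma3_neg_smul_smul] using (hu.1 z hz).1
  · have h := (hu.1 z hz).2 _ ((hiff z hz g).1 hg)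
    funext x
    have hx : expSigma3 (Complex.I * theta q0 x t z) j j • g x = u x z := congrFun h x
    change g x = expSigma3 (-(Complex.I * theta q0 x t z)) j j • u x z
    have h2 := expSigma3_neg_smul_smul (-(Complex.I * theta q0 x t z)) j (g x)
    rw [neg_neg, hx] at h2
    exact h2.symm
  · exact (((differentiableOn_expSigma3_theta j x t).mono hD').smul
      (hu.2 x).1.differentiableOn).analyticOnNhd hD
  · exact ((differentiableOn_expSigma3_theta j x t).continuousOn.mono hreg).smul (hu.2 x).2

end Existence

/-! ### Matrix problems and their columns -/

section Matrices

variable {q0 : ℝ} {q : ℝ → ℝ → ℂ} {qs : ℂ} {t : ℝ} {z : ℂ}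

theorem col_mul_expSigma3 (M : Mat2) (a : ℂ) (j : Fin 2) :
    (M * expSigma3 a).col j = expSigma3 a j j • M.col j := by
  funext i
  fin_cases j <;> simp [Matrix.mul_apply, Fin.sum_univ_two, expSigma3, mul_comm]

theorem continuous_iff_col {U : ℝ → Mat2} :
    Continuous U ↔ ∀ j, Continuous fun x => (U x).col j :=
  ⟨fun h j => continuous_pi fun i => h.matrix_elem i j,
    fun h => continuous_matrix fun i j => (continuous_apply i).comp (h j)⟩

theorem tendsto_iff_col {U : ℝ → Mat2} {M : Mat2} {l : Filter ℝ} :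
    Tendsto U l (𝓝 M) ↔ ∀ j, Tendsto (fun x => (U x).col j) l (𝓝 (M.col j)) := by
  refine ⟨fun h j => tendsto_pi_nhds.2 fun i =>
    ((continuous_id.matrix_elem i j).tendsto M).comp h, fun h => ?_⟩
  have h2 : Tendsto (fun x i j => U x i j) l (𝓝 fun i j => M i j) :=
    tendsto_pi_nhds.2 fun i => tendsto_pi_nhds.2 fun j =>
      ((continuous_apply i).tendsto _).comp (h j)
  exact h2

/-- As the right factor of the Volterra kernel is diagonal, the `j`-th column of the integrand
depends on the `j`-th column of the unknown only. -/
theorem volterra_entry (x y : ℝ) (M : Mat2) (i j : Fin 2) :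
    (volterraLeft q0 q qs t z x y * M * volterraRight q0 z x y) i j =
      (volterraRight q0 z x y j j • (volterraLeft q0 q qs t z x y).mulVec (M.col j)) i := by
  change (volterraLeft q0 q qs t z x y * M * expSigma3 _).col j i = _
  rw [col_mul_expSigma3]
  rfl

theorem integrable_and_eq_integral_iff {μ : Measure ℝ} {f : ℝ → Fin 2 → ℂ} {d : Fin 2 → ℂ} :
    (Integrable f μ ∧ d = ∫ y, f y ∂μ) ↔
      ∀ i, Integrable (fun y => f y i) μ ∧ d i = ∫ y, f y i ∂μ := by
  rw [integrable_pi_iff, forall_and]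
  refine and_congr_right fun h => ?_
  simp only [funext_iff, eval_integral h]

theorem eq_sub_iff_sub_eq {G : Type*} [AddCommGroup G] {a b c : G} : a = b - c ↔ b - a = c := by
  rw [sub_eq_iff_eq_add, eq_sub_iff_add_eq, add_comm, eq_comm]

theorem isModifiedJostPlus_iff {U : ℝ → Mat2} :
    IsModifiedJostPlus q0 q qs t z U ↔
      ∀ j, IsModifiedJostColPlus q0 q qs t j z fun x => (U x).col j := by
  unfold IsModifiedJostPlus IsModifiedJostColPlus
  rw [forall_and, forall_and, continuous_iff_col, tendsto_iff_col]
  refine and_congr_right fun _ => and_congr_right fun _ => ?_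
  simp only [IntegrableOn, eq_sub_iff_sub_eq, integrable_and_eq_integral_iff, volterra_entry]
  exact ⟨fun h j x i => h x i j, fun h x i j => h j x i⟩

theorem isModifiedJostMinus_iff {U : ℝ → Mat2} :
    IsModifiedJostMinus q0 q qs t z U ↔
      ∀ j, IsModifiedJostColMinus q0 q qs t j z fun x => (U x).col j := by
  unfold IsModifiedJostMinus IsModifiedJostColMinus
  rw [forall_and, forall_and, continuous_iff_col, tendsto_iff_col]
  refine and_congr_right fun _ => and_congr_right fun _ => ?_
  simp only [IntegrableOn, ← sub_eq_iff_eq_add', integrable_and_eq_integral_iff, volterra_entry]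
  exact ⟨fun h j x i => h x i j, fun h x i j => h j x i⟩

theorem isJost_iff (hqs : ‖qs‖ = q0) (hz : z ∈ regularSet q0)
    (hQ : LocallyIntegrable (deltaQ q qs t) volume) {l : Filter ℝ} {Ψ : ℝ → Mat2} :
    IsJost l q0 q qs t z Ψ ↔ ∀ j, IsJostCol l q0 q qs t j z fun x => (Ψ x).col j := by
  unfold IsJost IsJostCol
  rw [forall_and, forall_and, continuous_iff_col, tendsto_iff_col]
  simp only [col_mul_expSigma3]
  refine and_congr_right fun hc => and_congr_left fun _ => ?_
  have hint : ∀ (a b : ℝ) (i j : Fin 2),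
      (∫ y in a..b, (laxX q0 q y t z).mulVec ((Ψ y).col j)) i =
        ∫ y in a..b, (laxX q0 q y t z * Ψ y) i j := by
    intro a b i j
    have h := locallyIntegrable_clm_apply (locallyIntegrable_laxX hqs hz hQ) (hc j)
    exact (ContinuousLinearMap.intervalIntegral_comp_comm
      (ContinuousLinearMap.proj (R := ℂ) (φ := fun _ : Fin 2 => ℂ) i)
      (intervalIntegrable_of_locallyIntegrable h a b)).symm
  simp only [← hint, funext_iff]
  exact ⟨fun h j a b i => h a b i j, fun h a b i j => h j a b i⟩

/-- A problem for matrices that splits into problems for the two columns is uniquely solvable as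
soon as both of these are. -/
theorem isTheUnique_of_cols {PM : (ℝ → Mat2) → Prop} {PC : Fin 2 → (ℝ → Fin 2 → ℂ) → Prop}
    (hiff : ∀ U, PM U ↔ ∀ j, PC j fun x => (U x).col j) {U : ℝ → Mat2}
    (h : ∀ j, IsTheUnique (PC j) fun x => (U x).col j) : IsTheUnique PM U := by
  refine ⟨(hiff U).2 fun j => (h j).1, fun V hV => ?_⟩
  funext x
  ext i j
  exact congrFun (congrFun ((h j).2 _ ((hiff V).1 hV j)) x) i

end Matrices

/-! ### The regions `D⁺`, `D⁻` and the continuous spectrum -/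

section SpectralRegions

variable {q0 : ℝ} {z : ℂ}

/-- The sign of `Im λ` is that of `(|z|² - q₀²) Im z`. -/
theorem im_lam (hz : z ≠ 0) :
    2 * ‖z‖ ^ 2 * (lam q0 z).im = (‖z‖ ^ 2 - q0 ^ 2) * z.im := by
  have h0 : Complex.normSq z ≠ 0 := Complex.normSq_eq_zero.not.2 hz
  have h1 : ((q0 : ℂ) ^ 2 / z).im = -(q0 ^ 2 * z.im / Complex.normSq z) := by
    rw [← Complex.ofReal_pow, Complex.div_im, Complex.ofReal_re, Complex.ofReal_im]
    ring
  have h2 : (lam q0 z).im = (z.im + ((q0 : ℂ) ^ 2 / z).im) / 2 := by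
    rw [lam, ← Complex.add_im]
    exact Complex.div_ofNat_im _ 2
  rw [h2, h1, ← Complex.normSq_eq_norm_sq]
  field_simp
  ring

theorem colRate_zero_re : (colRate q0 0 z).re = -2 * (lam q0 z).im := by
  simp [colRate, colSign]

theorem colRate_one_re : (colRate q0 1 z).re = 2 * (lam q0 z).im := by
  simp [colRate, colSign]

theorem im_lam_nonpos_of_mem_DMinus (hz : z ∈ DMinus q0) : (lam q0 z).im ≤ 0 := by
  have h0 : z ≠ 0 := by rintro rfl; simp [DMinus] at hz
  have h := im_lam (q0 := q0) h0
  have hpos : 0 < ‖z‖ ^ 2 := by positivity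
  have hz' : (‖z‖ ^ 2 - q0 ^ 2) * z.im < 0 := hz
  nlinarith

theorem im_lam_nonneg_of_mem_DPlus (hz : z ∈ DPlus q0) : 0 ≤ (lam q0 z).im := by
  have h0 : z ≠ 0 := by rintro rfl; simp [DPlus] at hz
  have h := im_lam (q0 := q0) h0
  have hpos : 0 < ‖z‖ ^ 2 := by positivity
  have hz' : 0 < (‖z‖ ^ 2 - q0 ^ 2) * z.im := hz
  nlinarith

theorem im_lam_of_mem_Sigma0 (hz : z ∈ Sigma0 q0) : (lam q0 z).im = 0 := by
  have h := im_lam (q0 := q0) hz.2.1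
  have hpos : 0 < ‖z‖ ^ 2 := pow_pos (norm_pos_iff.2 hz.2.1) 2
  have hzero : (‖z‖ ^ 2 - q0 ^ 2) * z.im = 0 := by
    rcases hz.1 with h1 | h1 <;> simp [h1]
  rw [hzero] at h
  exact (mul_eq_zero.1 h).resolve_left (by positivity)

theorem mem_regularSet_iff :
    z ∈ regularSet q0 ↔ z ≠ 0 ∧ z ≠ Complex.I * q0 ∧ z ≠ -(Complex.I * q0) := by
  have h : z ^ 2 + (q0 : ℂ) ^ 2 = (z - Complex.I * q0) * (z + Complex.I * q0) := by
    ring_nf; simp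
  change z ≠ 0 ∧ z ^ 2 + (q0 : ℂ) ^ 2 ≠ 0 ↔ _
  rw [h, mul_ne_zero_iff, sub_ne_zero, ne_eq (z + _), add_eq_zero_iff_eq_neg]

theorem Sigma0_subset_regularSet : Sigma0 q0 ⊆ regularSet q0 := fun _ hz =>
  mem_regularSet_iff.2 hz.2

theorem mem_regularSet_of_ne_zero (h : (‖z‖ ^ 2 - q0 ^ 2) * z.im ≠ 0) : z ∈ regularSet q0 := by
  refine mem_regularSet_iff.2 ⟨?_, ?_, ?_⟩ <;> rintro rfl <;> simp at h

theorem DMinus_union_subset : DMinus q0 ∪ Sigma0 q0 ⊆ regularSet q0 :=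
  union_subset (fun _ hz => mem_regularSet_of_ne_zero (ne_of_lt hz)) Sigma0_subset_regularSet

theorem DPlus_union_subset : DPlus q0 ∪ Sigma0 q0 ⊆ regularSet q0 :=
  union_subset (fun _ hz => mem_regularSet_of_ne_zero (ne_of_gt hz)) Sigma0_subset_regularSet

theorem isOpen_DMinus : IsOpen (DMinus q0) :=
  isOpen_lt (((continuous_norm.pow 2).sub continuous_const).mul Complex.continuous_im)
    continuous_const

theorem isOpen_DPlus : IsOpen (DPlus q0) :=
  isOpen_lt continuous_const
    (((continuous_norm.pow 2).sub continuous_const).mul Complex.continuous_im)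

theorem im_lam_nonpos_of_mem (hz : z ∈ DMinus q0 ∪ Sigma0 q0) : (lam q0 z).im ≤ 0 :=
  hz.elim im_lam_nonpos_of_mem_DMinus fun h => (im_lam_of_mem_Sigma0 h).le

theorem im_lam_nonneg_of_mem (hz : z ∈ DPlus q0 ∪ Sigma0 q0) : 0 ≤ (lam q0 z).im :=
  hz.elim im_lam_nonneg_of_mem_DPlus fun h => (im_lam_of_mem_Sigma0 h).ge

theorem colRate_re_of_mem_Sigma0 (hz : z ∈ Sigma0 q0) (j : Fin 2) : (colRate q0 j z).re = 0 := by
  have h := im_lam_of_mem_Sigma0 hz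
  fin_cases j
  · exact colRate_zero_re.trans (by rw [h, mul_zero])
  · exact colRate_one_re.trans (by rw [h, mul_zero])

end SpectralRegions

/-! ### Integrability of the potential on half-lines -/

section Potential

variable {f : ℝ → ℂ} {a b : ℂ}

/-- If a function differs from constants by integrable functions near both ends, then its
difference to the constant at `+∞` is integrable on every right half-line. -/
theorem integrableOn_Ioi_of_both_ends (ha : IntegrableOn (fun x => f x - a) (Ioi 0))
    (hb : IntegrableOn (fun x => f x - b) (Iio 0)) (x : ℝ) :
    IntegrableOn (fun x => f x - a) (Ioi x) := by
  have h1 : IntegrableOn (fun x => f x - a) (Ioc x 0) := by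
    rw [integrableOn_Ioc_iff_integrableOn_Ioo]
    have h2 : IntegrableOn (fun x => (f x - b) + (b - a)) (Ioo x 0) :=
      (hb.mono_set Ioo_subset_Iio_self).add (integrableOn_const (by simp))
    simpa using h2
  exact (h1.union ha).mono_set fun y hy => (le_or_gt y 0).imp (fun h => ⟨hy, h⟩) id

theorem integrableOn_Iio_of_both_ends (ha : IntegrableOn (fun x => f x - a) (Ioi 0))
    (hb : IntegrableOn (fun x => f x - b) (Iio 0)) (x : ℝ) :
    IntegrableOn (fun x => f x - b) (Iio x) := by
  have h1 : IntegrableOn (fun x => f x - b) (Ico 0 x) := by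
    rw [integrableOn_Ico_iff_integrableOn_Ioo]
    have h2 : IntegrableOn (fun x => (f x - a) + (a - b)) (Ioo 0 x) :=
      (ha.mono_set Ioo_subset_Ioi_self).add (integrableOn_const (by simp))
    simpa using h2
  exact (h1.union hb).mono_set fun y hy => (le_or_gt 0 y).imp (fun h => ⟨h, hy⟩) id

theorem locallyIntegrable_of_integrableOn_Iio {E : Type*} [NormedAddCommGroup E] {m : ℝ → E}
    (hm : ∀ x, IntegrableOn m (Iio x)) : LocallyIntegrable m volume := fun x =>
  ⟨Iio (x + 1), Iio_mem_nhds (by linarith), hm _⟩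

end Potential

/-! ### The Jost solutions -/

section JostMatrices

variable {q0 : ℝ} {q : ℝ → ℝ → ℂ} {qs : ℂ} {t : ℝ} {j : Fin 2} {D S : Set ℂ}

theorem isAnalyticSolution_jostColPlus (hqs : ‖qs‖ = q0)
    (hQ : ∀ x, IntegrableOn (deltaQ q qs t) (Ioi x)) (hD : IsOpen D)
    (hreg : D ∪ S ⊆ regularSet q0) (hre : ∀ z ∈ D ∪ S, 0 ≤ (colRate q0 j z).re) :
    IsAnalyticSolution (IsJostCol atTop q0 q qs t j) D S
      (fun x z => expSigma3 (-(Complex.I * theta q0 x t z)) j j • colPlus q0 q qs t j x z) :=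
  IsAnalyticSolution.jostCol hD hreg (fun z hz w => by
    rw [isJostCol_iff hqs (hreg hz) (locallyIntegrable_of_integrableOn_Ioi hQ),
      isModifiedJostColPlus_iff hqs (hreg hz),
      isLinearSol_iff_isVolterraSol (hre z hz) (matOp_colProj_idem hqs (hreg hz))
        (matOp_colProj_col hqs (hreg hz)) hQ])
    (isAnalyticSolution_colPlus hqs hQ hD hreg hre)

theorem isAnalyticSolution_jostColMinus (hqs : ‖qs‖ = q0)
    (hQ : ∀ x, IntegrableOn (deltaQ q qs t) (Iio x)) (hD : IsOpen D)
    (hreg : D ∪ S ⊆ regularSet q0) (hre : ∀ z ∈ D ∪ S, (colRate q0 j z).re ≤ 0) :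
    IsAnalyticSolution (IsJostCol atBot q0 q qs t j) D S
      (fun x z => expSigma3 (-(Complex.I * theta q0 x t z)) j j • colMinus q0 q qs t j x z) :=
  IsAnalyticSolution.jostCol hD hreg (fun z hz w => by
    rw [isJostCol_iff hqs (hreg hz) (locallyIntegrable_of_integrableOn_Iio hQ),
      isModifiedJostColMinus_iff hqs (hreg hz),
      isLinearSol_iff_isVolterraSolBot (hre z hz) (matOp_colProj_idem hqs (hreg hz))
        (matOp_colProj_col hqs (hreg hz)) hQ])
    (isAnalyticSolution_colMinus hqs hQ hD hreg hre)

/-- The matrix with prescribed columns, in the order of the arguments `x`, `z` used for the Jost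
solutions. -/
def ofCols (c : Fin 2 → ℝ → ℂ → Fin 2 → ℂ) (x : ℝ) (z : ℂ) : Mat2 :=
  Matrix.of fun i j => c j x z i

theorem ofCols_col (c : Fin 2 → ℝ → ℂ → Fin 2 → ℂ) (x : ℝ) (z : ℂ) (j : Fin 2) :
    (ofCols c x z).col j = c j x z := rfl

theorem ofCols_mul_expSigma3_col (c : Fin 2 → ℝ → ℂ → Fin 2 → ℂ) (x : ℝ) (z a : ℂ) (j : Fin 2) :
    (ofCols c x z * expSigma3 a).col j = expSigma3 a j j • c j x z := by
  rw [col_mul_expSigma3, ofCols_col]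

theorem mul_expSigma3_neg_mul (M : Mat2) (a : ℂ) : M * expSigma3 (-a) * expSigma3 a = M := by
  have h : expSigma3 (-a) * expSigma3 a = 1 := by
    ext i j
    fin_cases i <;> fin_cases j <;>
      simp [expSigma3, Matrix.mul_apply, Fin.sum_univ_two, ← Complex.exp_add]
  rw [Matrix.mul_assoc, h, Matrix.mul_one]

/-- On the continuous spectrum both columns are available, so the matrix problems at `+∞` are
uniquely solvable. -/
theorem isTheUnique_plus (hqs : ‖qs‖ = q0)
    (hQ : ∀ x, IntegrableOn (deltaQ q qs t) (Ioi x)) {z : ℂ} (hz : z ∈ Sigma0 q0) :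
    IsTheUnique (IsModifiedJostPlus q0 q qs t z) (fun x => ofCols (colPlus q0 q qs t) x z) ∧
    IsTheUnique (IsJost atTop q0 q qs t z) (fun x =>
      ofCols (colPlus q0 q qs t) x z * expSigma3 (-(Complex.I * theta q0 x t z))) := by
  -- The results on single columns are used with the empty set as domain of analyticity.
  have hreg : ∅ ∪ Sigma0 q0 ⊆ regularSet q0 := by
    rw [empty_union]; exact Sigma0_subset_regularSet
  have hre : ∀ j, ∀ z ∈ ∅ ∪ Sigma0 q0, 0 ≤ (colRate q0 j z).re := fun j z hz =>
    (colRate_re_of_mem_Sigma0 (by simpa using hz) j).ge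
  refine ⟨isTheUnique_of_cols (fun _ => isModifiedJostPlus_iff) fun j =>
    (isAnalyticSolution_colPlus hqs hQ isOpen_empty hreg (hre j)).1 z (Or.inr hz),
    isTheUnique_of_cols (fun _ => isJost_iff hqs (Sigma0_subset_regularSet hz)
      (locallyIntegrable_of_integrableOn_Ioi hQ)) fun j => ?_⟩
  simp only [ofCols_mul_expSigma3_col]
  exact (isAnalyticSolution_jostColPlus hqs hQ isOpen_empty hreg (hre j)).1 z (Or.inr hz)

theorem isTheUnique_minus (hqs : ‖qs‖ = q0)
    (hQ : ∀ x, IntegrableOn (deltaQ q qs t) (Iio x)) {z : ℂ} (hz : z ∈ Sigma0 q0) :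
    IsTheUnique (IsModifiedJostMinus q0 q qs t z) (fun x => ofCols (colMinus q0 q qs t) x z) ∧
    IsTheUnique (IsJost atBot q0 q qs t z) (fun x =>
      ofCols (colMinus q0 q qs t) x z * expSigma3 (-(Complex.I * theta q0 x t z))) := by
  have hreg : ∅ ∪ Sigma0 q0 ⊆ regularSet q0 := by
    rw [empty_union]; exact Sigma0_subset_regularSet
  have hre : ∀ j, ∀ z ∈ ∅ ∪ Sigma0 q0, (colRate q0 j z).re ≤ 0 := fun j z hz =>
    (colRate_re_of_mem_Sigma0 (by simpa using hz) j).le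
  refine ⟨isTheUnique_of_cols (fun _ => isModifiedJostMinus_iff) fun j =>
    (isAnalyticSolution_colMinus hqs hQ isOpen_empty hreg (hre j)).1 z (Or.inr hz),
    isTheUnique_of_cols (fun _ => isJost_iff hqs (Sigma0_subset_regularSet hz)
      (locallyIntegrable_of_integrableOn_Iio hQ)) fun j => ?_⟩
  simp only [ofCols_mul_expSigma3_col]
  exact (isAnalyticSolution_jostColMinus hqs hQ isOpen_empty hreg (hre j)).1 z (Or.inr hz)

end JostMatrices

end JostVolterra

open JostVolterra in
theorem proposition2p2 (q0 : ℝ) (hq0 : 0 < q0) (q : ℝ → ℝ → ℂ) (qp qm : ℂ)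
    (hqp : ‖qp‖ = q0) (hqm : ‖qm‖ = q0) (t : ℝ)
    (hlim_p : Tendsto (fun x => q x t) atTop (𝓝 qp))
    (hlim_m : Tendsto (fun x => q x t) atBot (𝓝 qm))
    (hint_p : IntegrableOn (fun x => q x t - qp) (Ioi 0))
    (hint_m : IntegrableOn (fun x => q x t - qm) (Iio 0)) :
    ∃ up um ψp ψm : ℝ → ℂ → KunduEckhaus.Mat2,
      -- the modified Jost matrices on the continuous spectrum
      (∀ z ∈ KunduEckhaus.Sigma0 q0,
        KunduEckhaus.IsTheUnique (KunduEckhaus.IsModifiedJostPlus q0 q qp t z)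
          (fun x => up x z) ∧
        KunduEckhaus.IsTheUnique (KunduEckhaus.IsModifiedJostMinus q0 q qm t z)
          (fun x => um x z)) ∧
      -- the Jost matrices on the continuous spectrum
      (∀ z ∈ KunduEckhaus.Sigma0 q0,
        KunduEckhaus.IsTheUnique (KunduEckhaus.IsJost atTop q0 q qp t z) (fun x => ψp x z) ∧
        KunduEckhaus.IsTheUnique (KunduEckhaus.IsJost atBot q0 q qm t z) (fun x => ψm x z)) ∧
      -- the relation between the two
      (∀ (x : ℝ) (z : ℂ),
        up x z = ψp x z * KunduEckhaus.expSigma3 (Complex.I * KunduEckhaus.theta q0 x t z) ∧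
        um x z = ψm x z * KunduEckhaus.expSigma3 (Complex.I * KunduEckhaus.theta q0 x t z)) ∧
      -- analyticity of the columns of `u₊` and `u₋`
      KunduEckhaus.IsAnalyticSolution (KunduEckhaus.IsModifiedJostColPlus q0 q qp t 0)
        (KunduEckhaus.DMinus q0) (KunduEckhaus.Sigma0 q0) (fun x z => (up x z).col 0) ∧
      KunduEckhaus.IsAnalyticSolution (KunduEckhaus.IsModifiedJostColMinus q0 q qm t 1)
        (KunduEckhaus.DMinus q0) (KunduEckhaus.Sigma0 q0) (fun x z => (um x z).col 1) ∧
      KunduEckhaus.IsAnalyticSolution (KunduEckhaus.IsModifiedJostColMinus q0 q qm t 0)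
        (KunduEckhaus.DPlus q0) (KunduEckhaus.Sigma0 q0) (fun x z => (um x z).col 0) ∧
      KunduEckhaus.IsAnalyticSolution (KunduEckhaus.IsModifiedJostColPlus q0 q qp t 1)
        (KunduEckhaus.DPlus q0) (KunduEckhaus.Sigma0 q0) (fun x z => (up x z).col 1) ∧
      -- analyticity of the columns of `ψ₊` and `ψ₋`
      KunduEckhaus.IsAnalyticSolution (KunduEckhaus.IsJostCol atTop q0 q qp t 0)
        (KunduEckhaus.DMinus q0) (KunduEckhaus.Sigma0 q0) (fun x z => (ψp x z).col 0) ∧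
      KunduEckhaus.IsAnalyticSolution (KunduEckhaus.IsJostCol atBot q0 q qm t 1)
        (KunduEckhaus.DMinus q0) (KunduEckhaus.Sigma0 q0) (fun x z => (ψm x z).col 1) ∧
      KunduEckhaus.IsAnalyticSolution (KunduEckhaus.IsJostCol atBot q0 q qm t 0)
        (KunduEckhaus.DPlus q0) (KunduEckhaus.Sigma0 q0) (fun x z => (ψm x z).col 0) ∧
      KunduEckhaus.IsAnalyticSolution (KunduEckhaus.IsJostCol atTop q0 q qp t 1)
        (KunduEckhaus.DPlus q0) (KunduEckhaus.Sigma0 q0) (fun x z => (ψp x z).col 1) := by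
  have hQp : ∀ x, IntegrableOn (deltaQ q qp t) (Ioi x) := fun x =>
    integrableOn_deltaQ (integrableOn_Ioi_of_both_ends hint_p hint_m x)
  have hQm : ∀ x, IntegrableOn (deltaQ q qm t) (Iio x) := fun x =>
    integrableOn_deltaQ (integrableOn_Iio_of_both_ends hint_p hint_m x)
  have hre0m : ∀ z ∈ KunduEckhaus.DMinus q0 ∪ KunduEckhaus.Sigma0 q0,
      0 ≤ (colRate q0 0 z).re := fun z hz => by
    rw [colRate_zero_re]; linarith [im_lam_nonpos_of_mem hz]
  have hre1m : ∀ z ∈ KunduEckhaus.DMinus q0 ∪ KunduEckhaus.Sigma0 q0,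
      (colRate q0 1 z).re ≤ 0 := fun z hz => by
    rw [colRate_one_re]; linarith [im_lam_nonpos_of_mem hz]
  have hre0p : ∀ z ∈ KunduEckhaus.DPlus q0 ∪ KunduEckhaus.Sigma0 q0,
      (colRate q0 0 z).re ≤ 0 := fun z hz => by
    rw [colRate_zero_re]; linarith [im_lam_nonneg_of_mem hz]
  have hre1p : ∀ z ∈ KunduEckhaus.DPlus q0 ∪ KunduEckhaus.Sigma0 q0,
      0 ≤ (colRate q0 1 z).re := fun z hz => by
    rw [colRate_one_re]; linarith [im_lam_nonneg_of_mem hz]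
  refine ⟨ofCols (colPlus q0 q qp t), ofCols (colMinus q0 q qm t),
    fun x z => ofCols (colPlus q0 q qp t) x z *
      KunduEckhaus.expSigma3 (-(Complex.I * KunduEckhaus.theta q0 x t z)),
    fun x z => ofCols (colMinus q0 q qm t) x z *
      KunduEckhaus.expSigma3 (-(Complex.I * KunduEckhaus.theta q0 x t z)),
    fun z hz => ⟨(isTheUnique_plus hqp hQp hz).1, (isTheUnique_minus hqm hQm hz).1⟩,
    fun z hz => ⟨(isTheUnique_plus hqp hQp hz).2, (isTheUnique_minus hqm hQm hz).2⟩,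
    fun x z => ⟨(mul_expSigma3_neg_mul _ _).symm, (mul_expSigma3_neg_mul _ _).symm⟩, ?_⟩
  simp only [ofCols_mul_expSigma3_col, ofCols_col]
  exact ⟨isAnalyticSolution_colPlus hqp hQp isOpen_DMinus DMinus_union_subset hre0m,
    isAnalyticSolution_colMinus hqm hQm isOpen_DMinus DMinus_union_subset hre1m,
    isAnalyticSolution_colMinus hqm hQm isOpen_DPlus DPlus_union_subset hre0p,
    isAnalyticSolution_colPlus hqp hQp isOpen_DPlus DPlus_union_subset hre1p,
    isAnalyticSolution_jostColPlus hqp hQp isOpen_DMinus DMinus_union_subset hre0m,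
    isAnalyticSolution_jostColMinus hqm hQm isOpen_DMinus DMinus_union_subset hre1m,
    isAnalyticSolution_jostColMinus hqm hQm isOpen_DPlus DPlus_union_subset hre0p,
    isAnalyticSolution_jostColPlus hqp hQp isOpen_DPlus DPlus_union_subset hre1p⟩
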